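/- **Definitions.** A bidirected graph $B$ is a finite loopless multigraph with a sign $\sigma(e,u)\in\{+,-\}$ for every edge $e$ and endpoint $u$ of $e$. An oriented edge is an edge $e$ together with a choice of one endpoint as its tail and the other as its head. A trail is a sequence $v_0\vec e_1v_1\dots\vec e_\ell v_\ell$ ($\ell\ge 0$) of vertices and oriented edges such that $\vec e_i$ has tail $v_{i-1}$ and head $v_i$, the edges $e_1,\dots,e_\ell$ are pairwise distinct, and $\sigma(e_{i+1},v_i)=-\sigma(e_i,v_i)$ for $1\le i<\ell$; it is trivial if $\ell=0$, and if $\ell\ge1$ it arrives at $v_\ell$ with sign $\sigma(e_\ell,v_\ell)$. A path is a trail with no repeated vertex; an almost path is a trail that is trivial or becomes a path when its last edge and last vertex are removed. Let $B$ be rooted at a vertex $r$. It is *clean* if it has no nontrivial almost path from $r$ to $r$, and *path-reachable* if for every edge $e$ there is a path starting in $r$ whose last edge is $e$ (in either orientation). A vertex $v$ is *plain* if for some sign $\alpha$ no path from $r$ arrives at $v$ with sign $\alpha$. An edge is *undirectable* if each of its two orientations is the last oriented edge of some almost path starting in $r$, and *directable* if exactly one of them is; that one is its natural orientation. The *undirectable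 components* are the components having at least one edge of the underlying undirected subgraph formed by the undirectable edges. The *skeleton* $D$ of $B$ is the directed multigraph obtained from $B$ by contracting every undirectable component $C$ onto the unique vertex of $C$ that is plain or equal to $r$ (all other vertices of $C$ thereby disappear, so that $V(D)\subseteq V(B)$), and giving every directable edge its natural orientation; $E(D)$ is the set of directable edges. Finally, $\kappa_B(r,x)$ and $\kappa_D(r,x)$ denote the maximum number of internally vertex-disjoint paths from $r$ to $x$ in $B$, respectively of internally vertex-disjoint directed paths from $r$ to $x$ in $D$. **Theorem.** Let $B$ be a clean, path-reachable bidirected graph rooted at $r$, and let $D$ be its skeleton. Then - $\kappa_B(r,x)=\kappa_D(r,x)$ for all $x\in V(D)\setminus\{r\}$; and - $\kappa_B(r,x)=1$ for all $x\in V(B)\setminus V(D)$. -/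

import Mathlib

open scoped Graph

/-- A bidirected graph: a loopless multigraph together with a signing of its half-edges, where a
half-edge is a pair of an edge and an endpoint of it. Signs are the units `1` and `-1`. -/
structure BidirectedGraph (α β : Type*) where
  graph : Graph α β
  loopless : graph.Loopless
  sign : {h : β × α // graph.Inc h.1 h.2} → ℤˣ

/-- The largest size of a set of objects from `S` whose lists of internal vertices are pairwise
disjoint, for an arbitrary assignment `internal` of lists of internal vertices. -/
noncomputable def maxInternallyDisjoint {α γ : Type*} (S : Set γ) (internal : γ → List α) : ℕ∞ :=
  ⨆ P ∈ {P : Set γ | P ⊆ S ∧ P.Pairwise fun p q => (internal p).Disjoint (internal q)}, P.encard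

namespace BidirectedGraph

variable {α β : Type*}

/-- An oriented edge `(e, u, v)`: an edge with its two endpoints, the tail `u` and the head `v`. -/
@[ext]
structure OrientedEdge (B : BidirectedGraph α β) where
  edge : β
  tail : α
  head : α
  isLink : B.graph.IsLink edge tail head

/-- The sign of the underlying edge at the tail. -/
def OrientedEdge.tailSign {B : BidirectedGraph α β} (d : B.OrientedEdge) : ℤˣ :=
  B.sign ⟨(d.edge, d.tail), d.isLink.inc_left⟩

/-- The sign of the underlying edge at the head. -/
def OrientedEdge.headSign {B : BidirectedGraph α β} (d : B.OrientedEdge) : ℤˣ :=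
  B.sign ⟨(d.edge, d.head), d.isLink.inc_right⟩

/-- A trail, given by its initial vertex and its sequence of oriented edges: consecutive edges
meet head to tail with opposite signs at the common vertex, and no edge is repeated. -/
@[ext]
structure Trail (B : BidirectedGraph α β) where
  start : α
  steps : List B.OrientedEdge
  start_mem : start ∈ V(B.graph)
  tail_first : ∀ d ∈ steps.head?, d.tail = start
  chain : steps.IsChain fun d d' => d'.tail = d.head ∧ d'.tailSign = -d.headSign
  edges_nodup : (steps.map OrientedEdge.edge).Nodup

namespace Trail

variable {B : BidirectedGraph α β}

/-- The sequence of vertices of a trail, from the initial to the terminal vertex. -/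
def vertices (T : B.Trail) : List α := T.start :: T.steps.map OrientedEdge.head

/-- The terminal vertex. -/
def finish (T : B.Trail) : α := T.vertices.getLast (List.cons_ne_nil _ _)

/-- The internal vertices: all but the initial and the terminal one. -/
def internalVertices (T : B.Trail) : List α := T.vertices.tail.dropLast

/-- A trail is trivial if it consists of a single vertex. -/
def IsTrivial (T : B.Trail) : Prop := T.steps = []

/-- A path is a trail without repeated vertices. -/
def IsPath (T : B.Trail) : Prop := T.vertices.Nodup

/-- An almost path is a trail that is trivial or becomes a path after the removal of its last edge
(together with its last vertex). -/
def IsAlmostPath (T : B.Trail) : Prop := T.IsTrivial ∨ T.vertices.dropLast.Nodup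

/-- The terminal edge of `T` is the oriented edge `d`. -/
def EndsWith (T : B.Trail) (d : B.OrientedEdge) : Prop := T.steps.getLast? = some d

end Trail

variable (B : BidirectedGraph α β)

/-- `B`, rooted at `r`, is clean: every `r`--`r` almost path is trivial. -/
def IsClean (r : α) : Prop :=
  ∀ T : B.Trail, T.IsAlmostPath → T.start = r → T.finish = r → T.IsTrivial

/-- `B`, rooted at `r`, is path-reachable: for every edge `e` there is a path that starts in `r`
and whose terminal edge is `e`, in some orientation. -/
def IsPathReachable (r : α) : Prop :=
  ∀ e ∈ E(B.graph), ∃ T : B.Trail, T.IsPath ∧ T.start = r ∧ ∃ d, T.EndsWith d ∧ d.edge = e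

/-- There is a path from `r` that arrives at `v` with sign `s`. -/
def HasSignedPath (r v : α) (s : ℤˣ) : Prop :=
  ∃ T : B.Trail, T.IsPath ∧ T.start = r ∧ ∃ d, T.EndsWith d ∧ d.head = v ∧ d.headSign = s

/-- The set of plain vertices of `B` rooted at `r`. -/
def plainVertices (r : α) : Set α := {v | v ∈ V(B.graph) ∧ ∃ s : ℤˣ, ¬ B.HasSignedPath r v s}

/-- The maximum number of internally vertex-disjoint paths from `v` to `w`. -/
noncomputable def kappa (v w : α) : ℕ∞ :=
  maxInternallyDisjoint {T : B.Trail | T.IsPath ∧ T.start = v ∧ T.finish = w}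
    Trail.internalVertices

/-- There is an almost path that starts in `r` and whose terminal edge is the oriented edge `d`. -/
def HasAlmostPath (r : α) (d : B.OrientedEdge) : Prop :=
  ∃ T : B.Trail, T.IsAlmostPath ∧ T.start = r ∧ T.EndsWith d

/-- Both orientations of `e` are terminal edges of almost paths from `r`. -/
def IsUndirectable (r : α) (e : β) : Prop :=
  e ∈ E(B.graph) ∧ ∀ d : B.OrientedEdge, d.edge = e → B.HasAlmostPath r d

/-- `d` is the natural orientation of its underlying edge, which is then called directable: it is
the only orientation of that edge that is the terminal edge of an almost path from `r`. -/
def IsNaturalOrientation (r : α) (d : B.OrientedEdge) : Prop :=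
  B.HasAlmostPath r d ∧ ∀ d' : B.OrientedEdge, d'.edge = d.edge → B.HasAlmostPath r d' → d' = d

/-- The vertex set of the component of `v` in the subgraph formed by the undirectable edges. -/
def undirectableClass (r v : α) : Set α :=
  {w | Relation.ReflTransGen (fun a b => ∃ e, B.IsUndirectable r e ∧ B.graph.IsLink e a b) v w}

/-- The vertex sets of the undirectable components, i.e. of the components with at least one edge
of the subgraph formed by the undirectable edges. -/
def IsUndirectableComponent (r : α) (C : Set α) : Prop :=
  ∃ v, (∃ e, B.IsUndirectable r e ∧ B.graph.Inc e v) ∧ C = B.undirectableClass r v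

open Classical in
/-- The contraction map: each vertex of an undirectable component `C` is mapped to the unique
vertex of `C` that is plain or the root, and every other vertex to itself. -/
noncomputable def contract (r v : α) : α :=
  if h : ∃! c, ∃ C, B.IsUndirectableComponent r C ∧ v ∈ C ∧ c ∈ C ∧ c ∈ B.plainVertices r ∪ {r}
  then h.choose else v

end BidirectedGraph

/-- A directed multigraph; `IsArc e x y` says that `e` is an edge directed from `x` to `y`. -/
structure DirectedMultigraph (α β : Type*) where
  vertexSet : Set α
  IsArc : β → α → α → Prop
  tail_mem : ∀ {e x y}, IsArc e x y → x ∈ vertexSet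
  head_mem : ∀ {e x y}, IsArc e x y → y ∈ vertexSet
  ends_unique : ∀ {e x y x' y'}, IsArc e x y → IsArc e x' y' → x = x' ∧ y = y'

namespace DirectedMultigraph

variable {α β : Type*}

/-- An edge together with its tail and its head. -/
@[ext]
structure Arc (D : DirectedMultigraph α β) where
  edge : β
  tail : α
  head : α
  isArc : D.IsArc edge tail head

/-- A directed path, given by its initial vertex and its sequence of edges. -/
@[ext]
structure DirectedPath (D : DirectedMultigraph α β) where
  start : α
  steps : List D.Arc
  start_mem : start ∈ D.vertexSet
  tail_first : ∀ d ∈ steps.head?, d.tail = start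
  chain : steps.IsChain fun d d' => d'.tail = d.head
  vertices_nodup : (start :: steps.map Arc.head).Nodup

namespace DirectedPath

variable {D : DirectedMultigraph α β}

/-- The sequence of vertices of a directed path. -/
def vertices (P : D.DirectedPath) : List α := P.start :: P.steps.map Arc.head

/-- The terminal vertex. -/
def finish (P : D.DirectedPath) : α := P.vertices.getLast (List.cons_ne_nil _ _)

/-- The internal vertices: all but the initial and the terminal one. -/
def internalVertices (P : D.DirectedPath) : List α := P.vertices.tail.dropLast

end DirectedPath

/-- The maximum number of internally vertex-disjoint directed paths from `v` to `w`. -/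
noncomputable def kappa (D : DirectedMultigraph α β) (v w : α) : ℕ∞ :=
  maxInternallyDisjoint {P : D.DirectedPath | P.start = v ∧ P.finish = w}
    DirectedPath.internalVertices

end DirectedMultigraph

/-- The skeleton of `B` rooted at `r`: every undirectable component is contracted onto its unique
vertex that is plain or the root, and every directable edge gets its natural orientation. -/
noncomputable def BidirectedGraph.skeleton {α β : Type*} (B : BidirectedGraph α β) (r : α) :
    DirectedMultigraph α β where
  vertexSet := B.contract r '' V(B.graph)
  IsArc e x y := ∃ d : B.OrientedEdge, B.IsNaturalOrientation r d ∧ d.edge = e ∧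
    B.contract r d.tail = x ∧ B.contract r d.head = y
  tail_mem := by
    rintro e x y ⟨d, -, -, rfl, -⟩
    exact ⟨d.tail, d.isLink.left_mem, rfl⟩
  head_mem := by
    rintro e x y ⟨d, -, -, -, rfl⟩
    exact ⟨d.head, d.isLink.right_mem, rfl⟩
  ends_unique := by
    rintro e x y x' y' ⟨d, hd, rfl, rfl, rfl⟩ ⟨d', hd', he, rfl, rfl⟩
    obtain rfl := hd.2 d' he hd'.1
    exact ⟨rfl, rfl⟩

/-! An almost path ending in an oriented edge `d` is a path to the tail of `d` that arrives there
with the sign that allows `d` to follow (`hasAlmostPath_iff`). Directability thus depends only on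
which pairs of a vertex and an arrival sign are reachable from `r`, and plain vertices other than
`r` are those that miss a sign.

The structure behind the theorem is that of blobs. A base is a vertex reachable with exactly one
sign; a blob is a set whose other vertices are all reachable from the base with both signs, inside
the set. A root path can enter a blob only at its base, since otherwise it could run backwards to
the base and arrive with the forbidden sign. Hence blobs with distinct bases are disjoint
(`IsBlob.disjoint`), and adding an ear to a blob gives a blob (`IsBlob.ear`). If an edge is
undirectable, the two root paths to its ends and the edge itself form an ear on a common blob, or a
closed almost path at `r`, which cleanness excludes (`exists_inBlob`). So each undirectable
component lies in one blob, where only the base can be plain. Conversely a root path uses only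
undirectable edges after its last plain vertex, so every component contains a plain vertex and the
contraction is as intended.

Naturally oriented edges have plain heads. Dropping the undirectable edges of a root path with a
plain end therefore gives a directed path in `D` on a subset of its vertices
(`exists_directedPath`). Conversely, consecutive arcs of `D` are joined by a walk inside the
component contracted onto their common vertex; the signs match because that vertex is a base
(`exists_lift`). Both operations preserve internal disjointness. Finally, every root path to a
vertex that is not plain passes through the vertex onto which its end is contracted, so no two such
paths are internally disjoint (`kappa_eq_one`). -/

namespace BidirectedGraph

variable {α β : Type*} {B : BidirectedGraph α β}

theorem sign_eq_or_eq_neg (s t : ℤˣ) : s = t ∨ s = -t := by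
  rcases Int.units_eq_one_or s with rfl | rfl <;> rcases Int.units_eq_one_or t with rfl | rfl <;>
    simp

theorem neg_sign_ne (s : ℤˣ) : -s ≠ s := by
  rcases Int.units_eq_one_or s with rfl | rfl <;> decide

namespace OrientedEdge

/-- The opposite orientation of an oriented edge. -/
def rev (d : B.OrientedEdge) : B.OrientedEdge := ⟨d.edge, d.head, d.tail, d.isLink.symm⟩

@[simp] theorem rev_tail (d : B.OrientedEdge) : d.rev.tail = d.head := rfl
@[simp] theorem rev_head (d : B.OrientedEdge) : d.rev.head = d.tail := rfl
@[simp] theorem rev_tailSign (d : B.OrientedEdge) : d.rev.tailSign = d.headSign := rfl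
@[simp] theorem rev_headSign (d : B.OrientedEdge) : d.rev.headSign = d.tailSign := rfl

theorem tail_ne_head (d : B.OrientedEdge) : d.tail ≠ d.head := by
  have := B.loopless
  exact d.isLink.ne

theorem rev_ne (d : B.OrientedEdge) : d.rev ≠ d := fun h =>
  d.tail_ne_head (congrArg OrientedEdge.tail h).symm

theorem eq_or_eq_rev {d d' : B.OrientedEdge} (h : d.edge = d'.edge) : d = d' ∨ d = d'.rev := by
  have h₁ := d.isLink
  rw [h] at h₁
  rcases h₁.eq_and_eq_or_eq_and_eq d'.isLink with ⟨h₂, h₃⟩ | ⟨h₂, h₃⟩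
  · exact Or.inl (OrientedEdge.ext h h₂ h₃)
  · exact Or.inr (OrientedEdge.ext h h₂ h₃)

end OrientedEdge

/-! ### Walks between signed arrival states -/

/-- `IsWalk L u a v s`: the oriented edges in `L` form a walk that continues an arrival at `u` with
sign `a` and that arrives at `v` with sign `s`; the empty walk does not change the state. -/
def IsWalk : List B.OrientedEdge → α → ℤˣ → α → ℤˣ → Prop
  | [], u, a, v, s => u = v ∧ a = s
  | d :: L, u, a, v, s => d.tail = u ∧ d.tailSign = -a ∧ IsWalk L d.head d.headSign v s

/-- The reversal of a list of oriented edges. -/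
def revSteps (L : List B.OrientedEdge) : List B.OrientedEdge := (L.map OrientedEdge.rev).reverse

theorem isWalk_nil (u : α) (a : ℤˣ) : IsWalk ([] : List B.OrientedEdge) u a u a := ⟨rfl, rfl⟩

theorem isWalk_append {L M : List B.OrientedEdge} {u v : α} {a s : ℤˣ} :
    IsWalk (L ++ M) u a v s ↔ ∃ w t, IsWalk L u a w t ∧ IsWalk M w t v s := by
  induction L generalizing u a with
  | nil => simp [IsWalk]
  | cons d L ih => simp only [List.cons_append, IsWalk, ih]; tauto

theorem IsWalk.append {L M : List B.OrientedEdge} {u v w : α} {a s t : ℤˣ}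
    (h : IsWalk L u a w t) (h' : IsWalk M w t v s) : IsWalk (L ++ M) u a v s :=
  isWalk_append.2 ⟨w, t, h, h'⟩

theorem isWalk_singleton {d : B.OrientedEdge} {u v : α} {a s : ℤˣ} :
    IsWalk [d] u a v s ↔ d.tail = u ∧ d.tailSign = -a ∧ d.head = v ∧ d.headSign = s := Iff.rfl

theorem IsWalk.reverse {L : List B.OrientedEdge} {u v : α} {a s : ℤˣ} (h : IsWalk L u a v s) :
    IsWalk (revSteps L) v (-s) u (-a) := by
  induction L generalizing u a with
  | nil => obtain ⟨rfl, rfl⟩ := h; exact isWalk_nil _ _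
  | cons d L ih =>
    obtain ⟨rfl, h₁, h₂⟩ := h
    simp only [revSteps, List.map_cons, List.reverse_cons]
    exact (ih h₂).append (isWalk_singleton.2 ⟨rfl, by simp, rfl, by simp [h₁]⟩)

theorem IsWalk.tails_append {L : List B.OrientedEdge} {u v : α} {a s : ℤˣ}
    (h : IsWalk L u a v s) :
    L.map OrientedEdge.tail ++ [v] = u :: L.map OrientedEdge.head := by
  induction L generalizing u a with
  | nil => obtain ⟨rfl, rfl⟩ := h; rfl
  | cons d L ih =>
    obtain ⟨rfl, -, h₂⟩ := h
    simp [ih h₂]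

theorem heads_revSteps (L : List B.OrientedEdge) :
    (revSteps L).map OrientedEdge.head = (L.map OrientedEdge.tail).reverse := by
  simp [revSteps, Function.comp_def]

theorem tails_revSteps (L : List B.OrientedEdge) :
    (revSteps L).map OrientedEdge.tail = (L.map OrientedEdge.head).reverse := by
  simp [revSteps, Function.comp_def]

theorem IsWalk.start_cons_heads_revSteps {L : List B.OrientedEdge} {u v : α} {a s : ℤˣ}
    (h : IsWalk L u a v s) :
    v :: (revSteps L).map OrientedEdge.head = (u :: L.map OrientedEdge.head).reverse := by
  rw [heads_revSteps, ← h.tails_append]; simp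

theorem IsWalk.finish_mem {L : List B.OrientedEdge} {u v : α} {a s : ℤˣ}
    (h : IsWalk L u a v s) : v ∈ u :: L.map OrientedEdge.head := by
  rw [← h.tails_append]; simp

theorem IsWalk.eq_of_eq_concat {L : List B.OrientedEdge} {d : B.OrientedEdge} {u v : α}
    {a s : ℤˣ} (h : IsWalk (L ++ [d]) u a v s) :
    IsWalk L u a d.tail (-d.tailSign) ∧ d.head = v ∧ d.headSign = s := by
  obtain ⟨w, t, h₁, rfl, h₂, h₃⟩ := isWalk_append.1 h
  refine ⟨?_, h₃⟩
  rw [h₂, neg_neg]; exact h₁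

theorem IsWalk.split {L M : List B.OrientedEdge} {d : B.OrientedEdge} {u v : α}
    {a s : ℤˣ} (h : IsWalk (L ++ d :: M) u a v s) :
    IsWalk L u a d.tail (-d.tailSign) ∧ IsWalk (L ++ [d]) u a d.head d.headSign ∧
      IsWalk M d.head d.headSign v s := by
  obtain ⟨w, t, h₁, rfl, h₂, h₃⟩ := isWalk_append.1 h
  obtain rfl : t = -d.tailSign := by rw [h₂, neg_neg]
  exact ⟨h₁, h₁.append (isWalk_singleton.2 ⟨rfl, h₂, rfl, rfl⟩), h₃⟩

theorem IsWalk.exists_first {L : List B.OrientedEdge} {u v : α} {a s : ℤˣ}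
    (h : IsWalk L u a v s) (p : α → Prop) (hp : ∃ w ∈ u :: L.map OrientedEdge.head, p w) :
    ∃ A C w t, L = A ++ C ∧ IsWalk A u a w t ∧ IsWalk C w t v s ∧ p w ∧
      ∀ x ∈ A.map OrientedEdge.tail, ¬ p x := by
  by_cases hu : p u
  · exact ⟨[], L, u, a, rfl, isWalk_nil _ _, h, hu, by simp⟩
  induction L generalizing u a with
  | nil => simp [hu] at hp
  | cons d L ih =>
    obtain ⟨rfl, h₁, h₂⟩ := h
    by_cases hd : p d.head
    · exact ⟨[d], L, d.head, d.headSign, rfl, ⟨rfl, h₁, isWalk_nil _ _⟩, h₂, hd, by simpa using hu⟩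
    · obtain ⟨A, C, w, t, rfl, hA, hC, hw, hlast⟩ := ih h₂ (by simpa [hu] using hp) hd
      refine ⟨d :: A, C, w, t, rfl, ⟨rfl, h₁, hA⟩, hC, hw, ?_⟩
      intro x hx
      rcases List.mem_cons.1 hx with rfl | hx
      · exact hu
      · exact hlast x hx

theorem IsWalk.exists_last {L : List B.OrientedEdge} {u v : α} {a s : ℤˣ}
    (h : IsWalk L u a v s) (p : α → Prop) (hp : ∃ w ∈ u :: L.map OrientedEdge.head, p w) :
    ∃ A C w t, L = A ++ C ∧ IsWalk A u a w t ∧ IsWalk C w t v s ∧ p w ∧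
      ∀ x ∈ C.map OrientedEdge.head, ¬ p x := by
  induction L generalizing u a with
  | nil =>
    refine ⟨[], [], u, a, rfl, isWalk_nil _ _, h, by simpa using hp, by simp⟩
  | cons d L ih =>
    have h' := h
    obtain ⟨rfl, h₁, h₂⟩ := h
    by_cases hd : ∃ w ∈ d.head :: L.map OrientedEdge.head, p w
    · obtain ⟨A, C, w, t, rfl, hA, hC, hw, hlast⟩ := ih h₂ hd
      exact ⟨d :: A, C, w, t, rfl, ⟨rfl, h₁, hA⟩, hC, hw, hlast⟩
    · refine ⟨[], d :: L, d.tail, a, rfl, isWalk_nil _ _, h', ?_, by simpa using hd⟩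
      push Not at hd
      obtain ⟨w, hw, hpw⟩ := hp
      rcases List.mem_cons.1 hw with rfl | hw
      · exact hpw
      · exact absurd hpw (hd w (by simpa using hw))

/-- With distinct tails, an edge could recur only reversed, and then immediately, since its second
tail is its first head. The sign change at that vertex forbids this. Almost paths can therefore be
built without checking edges. -/
theorem IsWalk.edges_nodup {L : List B.OrientedEdge} {u v : α} {a s : ℤˣ}
    (h : IsWalk L u a v s) (hL : (L.map OrientedEdge.tail).Nodup) :
    (L.map OrientedEdge.edge).Nodup := by
  induction L generalizing u a with
  | nil => simp
  | cons d L ih =>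
    obtain ⟨rfl, h₁, h₂⟩ := h
    simp only [List.map_cons, List.nodup_cons] at hL ⊢
    refine ⟨?_, ih h₂ hL.2⟩
    intro hmem
    obtain ⟨d', hd', he⟩ := List.mem_map.1 hmem
    rcases OrientedEdge.eq_or_eq_rev he with rfl | rfl
    · exact hL.1 (List.mem_map_of_mem hd')
    · cases L with
      | nil => simp at hd'
      | cons d₁ L =>
        obtain ⟨h₃, h₄, -⟩ := h₂
        rcases List.mem_cons.1 hd' with rfl | hd'
        · exact neg_sign_ne _ h₄.symm
        · have := List.mem_map_of_mem (f := OrientedEdge.tail) hd'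
          simp only [List.map_cons, List.nodup_cons] at hL
          exact hL.2.1 (h₃ ▸ this)

theorem IsWalk.tails_nodup {L : List B.OrientedEdge} {u v : α} {a s : ℤˣ}
    (h : IsWalk L u a v s) (hL : (u :: L.map OrientedEdge.head).Nodup) :
    (L.map OrientedEdge.tail).Nodup := by
  rw [← h.tails_append] at hL
  exact hL.of_append_left

theorem IsWalk.isChain {L : List B.OrientedEdge} {u v : α} {a s : ℤˣ} (h : IsWalk L u a v s) :
    L.IsChain fun d d' => d'.tail = d.head ∧ d'.tailSign = -d.headSign := by
  induction L generalizing u a with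
  | nil => exact .nil
  | cons d L ih =>
    obtain ⟨rfl, h₁, h₂⟩ := h
    cases L with
    | nil => exact .singleton _
    | cons d' L => exact .cons_cons ⟨h₂.1, h₂.2.1⟩ (ih h₂)

/-- The trail that runs along a walk without repeated tails. -/
def IsWalk.toTrail {L : List B.OrientedEdge} {u v : α} {a s : ℤˣ} (h : IsWalk L u a v s)
    (hu : u ∈ V(B.graph)) (hL : (L.map OrientedEdge.tail).Nodup) : B.Trail where
  start := u
  steps := L
  start_mem := hu
  tail_first := by
    cases L with
    | nil => simp
    | cons d L => simpa using h.1
  chain := h.isChain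
  edges_nodup := h.edges_nodup hL

theorem IsWalk.getLast_eq {L : List B.OrientedEdge} {u v : α} {a s : ℤˣ} (h : IsWalk L u a v s) :
    (u :: L.map OrientedEdge.head).getLast (List.cons_ne_nil _ _) = v := by
  simp only [← h.tails_append]; simp

theorem IsWalk.dropLast_eq {L : List B.OrientedEdge} {u v : α} {a s : ℤˣ}
    (h : IsWalk L u a v s) :
    (u :: L.map OrientedEdge.head).dropLast = L.map OrientedEdge.tail := by
  simp [← h.tails_append]

theorem exists_isWalk_of_isChain {L : List B.OrientedEdge} {u : α}
    (h₁ : ∀ d ∈ L.head?, d.tail = u)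
    (h₂ : L.IsChain fun d d' => d'.tail = d.head ∧ d'.tailSign = -d.headSign) :
    ∃ a v s, IsWalk L u a v s ∧ ∀ d ∈ L.head?, a = -d.tailSign := by
  induction L generalizing u with
  | nil => exact ⟨1, u, 1, isWalk_nil _ _, by simp⟩
  | cons d L ih =>
    have h₂' := List.isChain_cons.1 h₂
    obtain ⟨a, v, s, hw, ha⟩ := ih (u := d.head) (fun d' hd' => (h₂'.1 d' hd').1) h₂'.2
    refine ⟨-d.tailSign, ?_⟩
    cases L with
    | nil =>
      exact ⟨d.head, d.headSign, ⟨h₁ d rfl, by simp, isWalk_nil _ _⟩, by simp⟩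
    | cons d' L =>
      have := ha d' rfl
      rw [(h₂'.1 d' rfl).2, neg_neg] at this
      subst this
      exact ⟨v, s, ⟨h₁ d rfl, by simp, hw⟩, by simp⟩

theorem Trail.exists_isWalk (T : B.Trail) : ∃ a s, IsWalk T.steps T.start a T.finish s := by
  obtain ⟨a, v, s, h, -⟩ := exists_isWalk_of_isChain T.tail_first T.chain
  obtain rfl : T.finish = v := h.getLast_eq
  exact ⟨a, s, h⟩

variable (B) in
/-- Some path from `r` arrives at `v` with sign `s`, where the trivial path arrives at `r` with
either sign. -/
def Reach (r v : α) (s : ℤˣ) : Prop :=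
  ∃ (a : ℤˣ) (L : List B.OrientedEdge), IsWalk L r a v s ∧ (r :: L.map OrientedEdge.head).Nodup

theorem reach_self (r : α) (s : ℤˣ) : B.Reach r r s := ⟨s, [], isWalk_nil _ _, by simp⟩

theorem Reach.of_isWalk_append {A C : List B.OrientedEdge} {r v : α} {a s : ℤˣ}
    (h : IsWalk A r a v s) (hn : (r :: (A ++ C).map OrientedEdge.head).Nodup) :
    B.Reach r v s := by
  refine ⟨a, A, h, ?_⟩
  rw [List.map_append, ← List.cons_append] at hn
  exact hn.of_append_left

end BidirectedGraph

/-! ### Blobs and their bases -/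

namespace BidirectedGraph

variable {α β : Type*} {B : BidirectedGraph α β}

variable (B) in
/-- `b` can be reached from `r` with sign `a`, but not with sign `-a`. -/
def IsBase (r b : α) (a : ℤˣ) : Prop := B.Reach r b a ∧ ¬ B.Reach r b (-a)

theorem IsBase.ne {r b : α} {a : ℤˣ} (h : B.IsBase r b a) : b ≠ r := by
  rintro rfl
  exact h.2 (reach_self _ _)

theorem IsBase.sign_eq {r b : α} {a t : ℤˣ} (h : B.IsBase r b a) (ht : B.Reach r b t) : t = a := by
  rcases sign_eq_or_eq_neg t a with rfl | rfl
  · rfl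
  · exact absurd ht h.2

variable (B) in
/-- Every vertex of `Y` other than `b` can be reached within `Y`, with both signs, by a path that
continues an arrival at `b` with sign `a`. -/
def IsBlob (b : α) (a : ℤˣ) (Y : Set α) : Prop :=
  b ∈ Y ∧ ∀ v ∈ Y, v ≠ b → ∀ s, ∃ L : List B.OrientedEdge, IsWalk L b a v s ∧
    (b :: L.map OrientedEdge.head).Nodup ∧ ∀ w ∈ L.map OrientedEdge.head, w ∈ Y

theorem isBlob_singleton (b : α) (a : ℤˣ) : B.IsBlob b a {b} :=
  ⟨rfl, fun _ hv hne => absurd hv hne⟩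

theorem IsBlob.exists_isWalk {b v : α} {a t : ℤˣ} {Y : Set α} (hY : B.IsBlob b a Y) (hv : v ∈ Y)
    (ht : v = b → t = a) : ∃ L : List B.OrientedEdge, IsWalk L b a v t ∧
    (b :: L.map OrientedEdge.head).Nodup ∧ ∀ w ∈ b :: L.map OrientedEdge.head, w ∈ Y := by
  by_cases h : v = b
  · subst h
    obtain rfl := ht rfl
    exact ⟨[], isWalk_nil _ _, by simp, by simpa using hv⟩
  · obtain ⟨L, h₁, h₂, h₃⟩ := hY.2 v hv h t
    exact ⟨L, h₁, h₂, List.forall_mem_cons.2 ⟨hY.1, h₃⟩⟩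

/-- A vertex of the ear is reached with one sign along the ear from `p`, and with the other by going
around through `q` and back across `d`. -/
theorem IsBlob.exists_isWalk_ear {b p q : α} {a a₁ a₂ s₁ s₂ : ℤˣ} {Y : Set α}
    (hY : B.IsBlob b a Y) {L₁ L₂ : List B.OrientedEdge} {d : B.OrientedEdge}
    (h₁ : IsWalk L₁ p a₁ d.tail s₁) (h₂ : IsWalk L₂ q a₂ d.head s₂)
    (hs₁ : d.tailSign = -s₁) (hs₂ : d.headSign = -s₂)
    (hp : p ∈ Y) (hq : q ∈ Y) (hpa : p = b → a₁ = a) (hqa : q = b → a₂ = a)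
    (hn₁ : (L₁.map OrientedEdge.head).Nodup) (hn₂ : (L₂.map OrientedEdge.head).Nodup)
    (hY₁ : ∀ w ∈ L₁.map OrientedEdge.head, w ∉ Y) (hY₂ : ∀ w ∈ L₂.map OrientedEdge.head, w ∉ Y)
    (hdis : ∀ w ∈ L₁.map OrientedEdge.head, w ∉ L₂.map OrientedEdge.head)
    {v : α} (hv : v ∈ L₁.map OrientedEdge.head) (s : ℤˣ) :
    ∃ L : List B.OrientedEdge, IsWalk L b a v s ∧ (b :: L.map OrientedEdge.head).Nodup ∧
      ∀ w ∈ L.map OrientedEdge.head,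
        w ∈ Y ∨ w ∈ L₁.map OrientedEdge.head ∨ w ∈ L₂.map OrientedEdge.head := by
  obtain ⟨f, hf, rfl⟩ := List.mem_map.1 hv
  obtain ⟨A, C, rfl⟩ := List.append_of_mem hf
  obtain ⟨-, hA, hC⟩ := h₁.split
  rcases sign_eq_or_eq_neg s f.headSign with rfl | rfl
  · obtain ⟨L, hL, hLn, hLY⟩ := hY.exists_isWalk hp hpa
    have happ : (A ++ f :: C).map OrientedEdge.head =
        (A ++ [f]).map OrientedEdge.head ++ C.map OrientedEdge.head := by simp
    have hsub : ∀ w ∈ (A ++ [f]).map OrientedEdge.head, w ∈ (A ++ f :: C).map OrientedEdge.head :=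
      fun w hw => happ ▸ List.mem_append_left _ hw
    refine ⟨L ++ (A ++ [f]), hL.append hA, ?_, ?_⟩
    · rw [List.map_append, ← List.cons_append, List.nodup_append]
      refine ⟨hLn, ?_, ?_⟩
      · rw [happ] at hn₁
        exact hn₁.of_append_left
      · rintro x hx y hy rfl
        exact hY₁ x (hsub x hy) (hLY x hx)
    · intro w hw
      rw [List.map_append, List.mem_append] at hw
      rcases hw with hw | hw
      · exact Or.inl (hLY w (List.mem_cons_of_mem _ hw))
      · exact Or.inr (Or.inl (hsub w hw))
  -- The opposite sign: follow `L₂`, cross `d` backwards and return along the part of `L₁` after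
  -- `f`.
  · obtain ⟨L, hL, hLn, hLY⟩ := hY.exists_isWalk hq hqa
    have hrev : IsWalk (d.rev :: revSteps C) d.head s₂ f.head (-f.headSign) :=
      ⟨rfl, hs₂, by simpa [hs₁] using hC.reverse⟩
    have hheads : (d.rev :: revSteps C).map OrientedEdge.head =
        (f.head :: C.map OrientedEdge.head).reverse := by
      rw [← hC.start_cons_heads_revSteps]; rfl
    have hsub : ∀ w ∈ f.head :: C.map OrientedEdge.head,
        w ∈ (A ++ f :: C).map OrientedEdge.head := by
      intro w hw; simp at hw ⊢; tauto
    refine ⟨L ++ (L₂ ++ d.rev :: revSteps C), hL.append (h₂.append hrev), ?_, ?_⟩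
    · rw [List.map_append, ← List.cons_append, List.nodup_append]
      refine ⟨hLn, ?_, ?_⟩
      · rw [List.map_append, hheads, List.nodup_append]
        refine ⟨hn₂, ?_, ?_⟩
        · rw [List.nodup_reverse]
          rw [List.map_append] at hn₁
          exact hn₁.of_append_right
        · rintro x hx y hy rfl
          exact hdis x (hsub x (List.mem_reverse.1 hy)) hx
      · rintro x hx y hy rfl
        rw [List.map_append, hheads, List.mem_append, List.mem_reverse] at hy
        rcases hy with hy | hy
        · exact hY₂ x hy (hLY x hx)
        · exact hY₁ x (hsub x hy) (hLY x hx)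
    · intro w hw
      rw [List.map_append, List.map_append, hheads, List.mem_append, List.mem_append,
        List.mem_reverse] at hw
      rcases hw with hw | hw | hw
      · exact Or.inl (hLY w (List.mem_cons_of_mem _ hw))
      · exact Or.inr (Or.inr hw)
      · exact Or.inr (Or.inl (hsub w hw))

theorem IsBlob.ear {b p q : α} {a a₁ a₂ s₁ s₂ : ℤˣ} {Y : Set α}
    (hY : B.IsBlob b a Y) {L₁ L₂ : List B.OrientedEdge} {d : B.OrientedEdge}
    (h₁ : IsWalk L₁ p a₁ d.tail s₁) (h₂ : IsWalk L₂ q a₂ d.head s₂)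
    (hs₁ : d.tailSign = -s₁) (hs₂ : d.headSign = -s₂)
    (hp : p ∈ Y) (hq : q ∈ Y) (hpa : p = b → a₁ = a) (hqa : q = b → a₂ = a)
    (hn₁ : (L₁.map OrientedEdge.head).Nodup) (hn₂ : (L₂.map OrientedEdge.head).Nodup)
    (hY₁ : ∀ w ∈ L₁.map OrientedEdge.head, w ∉ Y) (hY₂ : ∀ w ∈ L₂.map OrientedEdge.head, w ∉ Y)
    (hdis : ∀ w ∈ L₁.map OrientedEdge.head, w ∉ L₂.map OrientedEdge.head) :
    B.IsBlob b a
      {w | w ∈ Y ∨ w ∈ L₁.map OrientedEdge.head ∨ w ∈ L₂.map OrientedEdge.head} := by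
  refine ⟨Or.inl hY.1, ?_⟩
  rintro v (hv | hv | hv) hne s
  · obtain ⟨L, h, h', h''⟩ := hY.2 v hv hne s
    exact ⟨L, h, h', fun w hw => Or.inl (h'' w hw)⟩
  · exact hY.exists_isWalk_ear h₁ h₂ hs₁ hs₂ hp hq hpa hqa hn₁ hn₂ hY₁ hY₂ hdis hv s
  · obtain ⟨L, h, h', h''⟩ := hY.exists_isWalk_ear (d := d.rev) h₂ h₁ hs₂ hs₁ hq hp hqa hpa hn₂ hn₁
      hY₂ hY₁ (fun w hw hw' => hdis w hw' hw) hv s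
    exact ⟨L, h, h', fun w hw => (h'' w hw).imp_right Or.symm⟩

/-- If the first vertex in `Y` were not the base, the blob would contain a walk from the base to it
with the opposite arrival sign; its reversal would extend the path to the base with sign `-a`. -/
theorem IsBlob.exists_first {r b v : α} {a a₀ s : ℤˣ} {Y : Set α} (hY : B.IsBlob b a Y)
    (hb : B.IsBase r b a) {L : List B.OrientedEdge} (h : IsWalk L r a₀ v s)
    (hn : (r :: L.map OrientedEdge.head).Nodup)
    (hp : ∃ w ∈ r :: L.map OrientedEdge.head, w ∈ Y) :
    ∃ A C, L = A ++ C ∧ IsWalk A r a₀ b a ∧ IsWalk C b a v s ∧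
      ∀ x ∈ A.map OrientedEdge.tail, x ∉ Y := by
  obtain ⟨A, C, w, t, rfl, hA, hC, hw, hfirst⟩ := h.exists_first (· ∈ Y) hp
  have hn' : (r :: A.map OrientedEdge.head).Nodup := by
    rw [List.map_append, ← List.cons_append] at hn
    exact hn.of_append_left
  by_cases hwb : w = b
  · subst hwb
    obtain rfl := hb.sign_eq ⟨_, _, hA, hn'⟩
    exact ⟨A, C, rfl, hA, hC, hfirst⟩
  · obtain ⟨M, hM, hMn, hMY⟩ := hY.2 w hw hwb (-t)
    exfalso
    apply hb.2
    have hM' := hM.reverse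
    rw [neg_neg] at hM'
    refine ⟨a₀, A ++ revSteps M, hA.append hM', ?_⟩
    rw [List.map_append, ← List.cons_append, ← hA.tails_append, List.append_assoc,
      List.singleton_append, hM.start_cons_heads_revSteps, List.nodup_append, List.nodup_reverse]
    refine ⟨hA.tails_nodup hn', hMn, ?_⟩
    rintro x hx y hy rfl
    refine hfirst x hx ?_
    rcases List.mem_cons.1 (List.mem_reverse.1 hy) with rfl | hy
    · exact hY.1
    · exact hMY x hy

/-- A path to the base of a blob extends to a path to any vertex of the blob. -/
theorem IsBlob.exists_extension {r b v : α} {a a₀ s : ℤˣ} {Y : Set α} (hY : B.IsBlob b a Y)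
    (hb : B.IsBase r b a) {L : List B.OrientedEdge} (h : IsWalk L r a₀ b a)
    (hn : (r :: L.map OrientedEdge.head).Nodup) (hv : v ∈ Y) (hs : v = b → s = a) :
    ∃ M, IsWalk (L ++ M) r a₀ v s ∧ (r :: (L ++ M).map OrientedEdge.head).Nodup ∧
      ∀ w ∈ M.map OrientedEdge.head, w ∈ Y := by
  obtain ⟨A, C, rfl, hA, hC, hfirst⟩ := hY.exists_first hb h hn ⟨b, h.finish_mem, hY.1⟩
  obtain ⟨M, hM, hMn, hMY⟩ := hY.exists_isWalk hv hs
  -- The path visits `b` only at its end, so its first entry into `Y` is that end.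
  obtain rfl : C = [] := by
    rcases List.eq_nil_or_concat C with rfl | ⟨C, d, rfl⟩
    · rfl
    · exfalso
      simp only [List.concat_eq_append] at hC hn
      have hd := hC.eq_of_eq_concat.2.1
      rw [List.map_append, ← List.cons_append, ← hA.tails_append, List.nodup_append] at hn
      exact hn.2.2 b (by simp) b (by simp [hd]) rfl
  rw [List.append_nil] at h hn ⊢
  refine ⟨M, h.append hM, ?_, fun w hw => hMY w (List.mem_cons_of_mem _ hw)⟩
  rw [List.map_append, ← List.cons_append, ← hA.tails_append, List.append_assoc,
    List.singleton_append, List.nodup_append]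
  refine ⟨hA.tails_nodup hn, hMn, ?_⟩
  rintro x hx y hy rfl
  exact hfirst x hx (hMY x hy)

theorem IsBlob.reach {r b v : α} {a : ℤˣ} {Y : Set α} (hY : B.IsBlob b a Y)
    (hb : B.IsBase r b a) (hv : v ∈ Y) (hne : v ≠ b) (s : ℤˣ) : B.Reach r v s := by
  obtain ⟨a₀, L, hL, hn⟩ := hb.1
  obtain ⟨M, h₁, h₂, -⟩ := hY.exists_extension (s := s) hb hL hn hv (fun h => absurd h hne)
  exact ⟨_, _, h₁, h₂⟩

theorem IsBlob.not_mem_of_isBase {r b b' : α} {a a' : ℤˣ} {Y : Set α} (hY : B.IsBlob b a Y)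
    (hb : B.IsBase r b a) (hb' : B.IsBase r b' a') (hne : b' ≠ b) : b' ∉ Y :=
  fun h => hb'.2 (hY.reach hb h hne _)

/-- Infinite descent: a path to `b`, extended within `Y` to the common vertex, must first enter `Y'`
at `b'`. Since `b'` is not in `Y`, this happens strictly before `b`, which gives a shorter path to
`b'` and lets the two blobs swap roles. -/
theorem IsBlob.disjoint {r b b' v : α} {a a' : ℤˣ} {Y Y' : Set α} (hY : B.IsBlob b a Y)
    (hY' : B.IsBlob b' a' Y') (hb : B.IsBase r b a) (hb' : B.IsBase r b' a') (hne : b ≠ b')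
    (hv : v ∈ Y) (hv' : v ∈ Y') : False := by
  obtain ⟨a₀, L, hL, hn⟩ := hb.1
  induction hk : L.length using Nat.strong_induction_on generalizing b b' a a' Y Y' L a₀ with
  | _ k ih =>
  obtain ⟨s, hs⟩ : ∃ s, v = b → s = a := ⟨a, fun _ => rfl⟩
  obtain ⟨M, hM, hMn, hMY⟩ := hY.exists_extension (s := s) hb hL hn hv hs
  obtain ⟨A, C, hAC, hA, -, hfirst⟩ := hY'.exists_first hb' hM hMn ⟨v, hM.finish_mem, hv'⟩
  have hAn : (r :: A.map OrientedEdge.head).Nodup := by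
    rw [hAC, List.map_append, ← List.cons_append] at hMn
    exact hMn.of_append_left
  have hlen : A.length < L.length := by
    by_contra! hlen
    -- Otherwise all of `L` precedes the entry into `Y'`, and `b'` is `b` or a vertex of `Y`.
    have hpre : L <+: A := List.prefix_of_prefix_length_le (List.prefix_append L M)
      (hAC ▸ List.prefix_append A C) hlen
    obtain ⟨D, rfl⟩ := hpre
    rw [List.append_assoc, List.append_cancel_left_eq] at hAC
    subst hAC
    rcases List.eq_nil_or_concat D with rfl | ⟨D, d, rfl⟩
    · rw [List.append_nil] at hA
      exact hne (hL.getLast_eq.symm.trans hA.getLast_eq)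
    · rw [List.concat_eq_append] at hA hMY
      rw [← List.append_assoc] at hA
      obtain ⟨-, rfl, -⟩ := hA.eq_of_eq_concat
      exact hY.not_mem_of_isBase hb hb' hne.symm (hMY d.head (by simp))
  exact ih A.length (hk ▸ hlen) hY' hY hb' hb hne.symm hv' hv a₀ A hA hAn rfl

variable (B) in
/-- `v` belongs to the largest blob with base `b`, where the only blob of the root is `{r}`. -/
def InBlob (r b v : α) : Prop :=
  b = r ∧ v = r ∨ ∃ a Y, B.IsBase r b a ∧ B.IsBlob b a Y ∧ v ∈ Y

theorem IsBlob.root_not_mem {r b : α} {a : ℤˣ} {Y : Set α} (hY : B.IsBlob b a Y)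
    (hb : B.IsBase r b a) : r ∉ Y := by
  intro h
  obtain ⟨A, C, hAC, hA, -⟩ := hY.exists_first hb (isWalk_nil r a) (by simp) ⟨r, by simp, h⟩
  obtain ⟨rfl, rfl⟩ := List.append_eq_nil_iff.1 hAC.symm
  exact hb.ne hA.1.symm

theorem InBlob.unique {r b b' v : α} (h : B.InBlob r b v) (h' : B.InBlob r b' v) : b = b' := by
  rcases h with ⟨rfl, rfl⟩ | ⟨a, Y, hb, hY, hv⟩ <;>
    rcases h' with ⟨rfl, h'⟩ | ⟨a', Y', hb', hY', hv'⟩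
  · rfl
  · exact absurd hv' (hY'.root_not_mem hb')
  · exact absurd (h' ▸ hv) (hY.root_not_mem hb)
  · by_contra hne
    exact hY.disjoint hY' hb hb' hne hv hv'

/-- All blobs with base `b` use the same sign, the only one with which `b` is reachable, so their
union is a blob. -/
theorem IsBase.isBlob_inBlob {r b : α} {a : ℤˣ} (hb : B.IsBase r b a) :
    B.IsBlob b a {v | B.InBlob r b v} := by
  refine ⟨Or.inr ⟨a, {b}, hb, isBlob_singleton b a, rfl⟩, ?_⟩
  rintro v (⟨h, -⟩ | ⟨a', Y, hb', hY, hv⟩) hne s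
  · exact absurd h hb.ne
  · obtain rfl := hb.sign_eq hb'.1
    obtain ⟨L, h₁, h₂, h₃⟩ := hY.2 v hv hne s
    exact ⟨L, h₁, h₂, fun w hw => Or.inr ⟨_, Y, hb, hY, h₃ w hw⟩⟩

theorem InBlob.reach {r b v : α} (h : B.InBlob r b v) (hne : v ≠ b) (s : ℤˣ) : B.Reach r v s := by
  rcases h with ⟨rfl, rfl⟩ | ⟨a, Y, hb, hY, hv⟩
  · exact absurd rfl hne
  · exact hY.reach hb hv hne s

/-- Two root paths joined by an edge: if the vertices of one of them belong to blobs, then the ends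
of the edge lie in a common blob. -/
theorem exists_inBlob {r : α}
    (hclean : ∀ (L : List B.OrientedEdge) (a s : ℤˣ), IsWalk L r a r s →
      (L.map OrientedEdge.tail).Nodup → L = [])
    {P Q : List B.OrientedEdge} {d : B.OrientedEdge} {a₁ a₂ s₁ s₂ : ℤˣ}
    (hP : IsWalk P r a₁ d.tail s₁) (hQ : IsWalk Q r a₂ d.head s₂)
    (hs₁ : d.tailSign = -s₁) (hs₂ : d.headSign = -s₂)
    (hPn : (r :: P.map OrientedEdge.head).Nodup) (hQn : (r :: Q.map OrientedEdge.head).Nodup)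
    (hPU : ∀ w ∈ r :: P.map OrientedEdge.head, ∃ b, B.InBlob r b w) :
    ∃ b, B.InBlob r b d.tail ∧ B.InBlob r b d.head := by
  -- `z` is the last vertex of `Q` in a blob that also meets `P`, and `p` below is the last vertex
  -- of `P` in that blob. The segments after them avoid the blob. They also avoid each other: a
  -- common vertex would lie on `P`, hence in a blob meeting `P`, against the choice of `z`.
  obtain ⟨A₂, C₂, z, t₂, rfl, hA₂, hC₂, ⟨b, hzb, hbP⟩, hlast₂⟩ := hQ.exists_last
    (fun z => ∃ b, B.InBlob r b z ∧ ∃ w ∈ r :: P.map OrientedEdge.head, B.InBlob r b w)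
    ⟨r, by simp, r, Or.inl ⟨rfl, rfl⟩, r, by simp, Or.inl ⟨rfl, rfl⟩⟩
  have hbP' := hbP
  obtain ⟨A₁, C₁, p, t₁, rfl, hA₁, hC₁, hpb, hlast₁⟩ := hP.exists_last (B.InBlob r b) hbP
  have hdis : ∀ w ∈ C₁.map OrientedEdge.head, w ∉ C₂.map OrientedEdge.head := by
    intro w hw hw'
    have hwP : w ∈ r :: (A₁ ++ C₁).map OrientedEdge.head := by simp at hw ⊢; tauto
    obtain ⟨b', hb'⟩ := hPU w hwP
    exact hlast₂ w hw' ⟨b', hb', w, hwP, hb'⟩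
  have hlast₂' : ∀ w ∈ C₂.map OrientedEdge.head, ¬ B.InBlob r b w := fun w hw hwb =>
    hlast₂ w hw ⟨b, hwb, hbP'⟩
  have hn₁ : (C₁.map OrientedEdge.head).Nodup := by
    rw [List.map_append] at hPn
    exact hPn.of_cons.of_append_right
  have hn₂ : (C₂.map OrientedEdge.head).Nodup := by
    rw [List.map_append] at hQn
    exact hQn.of_cons.of_append_right
  have hr₁ : B.Reach r p t₁ := Reach.of_isWalk_append hA₁ hPn
  have hr₂ : B.Reach r z t₂ := Reach.of_isWalk_append hA₂ hQn
  have hear : ∀ a, B.IsBase r b a → ∃ b, B.InBlob r b d.tail ∧ B.InBlob r b d.head := by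
    intro a hb
    have hY := hb.isBlob_inBlob.ear hC₁ hC₂ hs₁ hs₂ hpb hzb
      (fun h => hb.sign_eq (h ▸ hr₁)) (fun h => hb.sign_eq (h ▸ hr₂)) hn₁ hn₂ hlast₁ hlast₂' hdis
    refine ⟨b, Or.inr ⟨a, _, hb, hY, ?_⟩, Or.inr ⟨a, _, hb, hY, ?_⟩⟩
    · rcases List.mem_cons.1 hC₁.finish_mem with h | h
      · exact Or.inl (h ▸ hpb)
      · exact Or.inr (Or.inl h)
    · rcases List.mem_cons.1 hC₂.finish_mem with h | h
      · exact Or.inl (h ▸ hzb)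
      · exact Or.inr (Or.inr h)
  rcases id hpb with ⟨rfl, rfl⟩ | ⟨a, -, hb, -, -⟩
  · rcases id hzb with ⟨-, rfl⟩ | ⟨a, -, hb, -, -⟩
    -- For the root, the would-be ear is a nontrivial almost path from `r` to `r`.
    · exfalso
      have hw : IsWalk (C₁ ++ d :: revSteps C₂) z t₁ z (-t₂) :=
        hC₁.append ⟨rfl, hs₁, by rw [hs₂]; exact hC₂.reverse⟩
      have := hclean _ _ _ hw ?_
      · simp at this
      · have hC₁b : ∀ w ∈ C₁.map OrientedEdge.head, w ≠ z := fun w hw h =>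
          hlast₁ w hw (h ▸ hpb)
        have hC₂b : ∀ w ∈ C₂.map OrientedEdge.head, w ≠ z := fun w hw h =>
          hlast₂' w hw (h ▸ hpb)
        rw [List.map_append, List.map_cons, tails_revSteps, ← List.singleton_append,
          ← List.append_assoc, hC₁.tails_append, List.nodup_append, List.nodup_cons,
          List.nodup_reverse]
        refine ⟨⟨fun h => hC₁b z h rfl, hn₁⟩, hn₂, ?_⟩
        rintro x hx y hy rfl
        rw [List.mem_reverse] at hy
        rcases List.mem_cons.1 hx with rfl | hx
        · exact hC₂b _ hy rfl
        · exact hdis x hx hy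
    · exact hear a hb
  · exact hear a hb

end BidirectedGraph

/-! ### Directability, plain vertices and the contraction -/

namespace BidirectedGraph

variable {α β : Type*} {B : BidirectedGraph α β}

variable (B) in
/-- `B` is a clean, path-reachable bidirected graph rooted at its vertex `r`. -/
structure IsCleanRooted (r : α) : Prop where
  root_mem : r ∈ V(B.graph)
  clean : B.IsClean r
  pathReachable : B.IsPathReachable r

theorem Trail.EndsWith.exists_isWalk {T : B.Trail} {d : B.OrientedEdge} (h : T.EndsWith d) :
    ∃ a L, T.steps = L ++ [d] ∧ IsWalk T.steps T.start a d.head d.headSign ∧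
      IsWalk L T.start a d.tail (-d.tailSign) := by
  obtain ⟨L, hL⟩ := List.getLast?_eq_some_iff.1 h
  obtain ⟨a, s, hw⟩ := T.exists_isWalk
  rw [hL] at hw
  obtain ⟨h₁, h₂, h₃⟩ := hw.eq_of_eq_concat
  rw [← h₂, ← h₃] at hw
  exact ⟨a, L, hL, hL ▸ hw, h₁⟩

theorem hasAlmostPath_iff {r : α} (hr : r ∈ V(B.graph)) {d : B.OrientedEdge} :
    B.HasAlmostPath r d ↔ B.Reach r d.tail (-d.tailSign) := by
  constructor
  · rintro ⟨T, hT, rfl, hd⟩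
    obtain ⟨a, L, hL, hw, hw'⟩ := hd.exists_isWalk
    refine ⟨a, L, hw', ?_⟩
    rcases hT with hT | hT
    · rw [Trail.IsTrivial, hL] at hT
      simp at hT
    · rw [Trail.vertices, hw.dropLast_eq, hL] at hT
      rw [← hw'.tails_append]
      simpa using hT
  · rintro ⟨a, L, hw, hn⟩
    have hw' : IsWalk (L ++ [d]) r a d.head d.headSign :=
      hw.append (isWalk_singleton.2 ⟨rfl, by simp, rfl, rfl⟩)
    have hn' : ((L ++ [d]).map OrientedEdge.tail).Nodup := by
      rw [← hw.tails_append] at hn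
      simpa using hn
    refine ⟨hw'.toTrail hr hn', Or.inr ?_, rfl, ?_⟩
    · rw [Trail.vertices]
      exact hw'.dropLast_eq ▸ hn'
    · simp [Trail.EndsWith, IsWalk.toTrail]

theorem Reach.of_hasSignedPath {r v : α} {s : ℤˣ} (h : B.HasSignedPath r v s) :
    v ≠ r ∧ B.Reach r v s := by
  obtain ⟨T, hT, rfl, d, hd, rfl, rfl⟩ := h
  obtain ⟨a, L, hL, hw, -⟩ := hd.exists_isWalk
  refine ⟨?_, a, T.steps, hw, hT⟩
  intro h
  rw [Trail.IsPath, Trail.vertices, hL, ← h] at hT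
  simp at hT

theorem Reach.exists_path {r v : α} (hr : r ∈ V(B.graph)) {s : ℤˣ} (h : B.Reach r v s) :
    ∃ T : B.Trail, T.IsPath ∧ T.start = r ∧ T.finish = v := by
  obtain ⟨a, L, hw, hn⟩ := h
  exact ⟨hw.toTrail hr (hw.tails_nodup hn), hn, rfl, hw.getLast_eq⟩

theorem hasSignedPath_iff {r v : α} (hr : r ∈ V(B.graph)) (hv : v ≠ r) {s : ℤˣ} :
    B.HasSignedPath r v s ↔ B.Reach r v s := by
  refine ⟨fun h => (Reach.of_hasSignedPath h).2, ?_⟩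
  rintro ⟨a, L, hw, hn⟩
  rcases List.eq_nil_or_concat L with rfl | ⟨L, d, rfl⟩
  · exact absurd hw.1.symm hv
  · rw [List.concat_eq_append] at hw hn
    exact ⟨hw.toTrail hr (hw.tails_nodup hn), hn, rfl, d, by simp [Trail.EndsWith, IsWalk.toTrail],
      hw.eq_of_eq_concat.2⟩

/-- The root is always plain, as no nontrivial path returns to it, whereas `Reach` holds at `r` for
both signs. This is why the root is listed separately. -/
theorem mem_plainVertices_iff {r v : α} (hr : r ∈ V(B.graph)) :
    v ∈ B.plainVertices r ↔ v ∈ V(B.graph) ∧ (v = r ∨ ∃ s, ¬ B.Reach r v s) := by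
  refine and_congr_right fun hv => ?_
  by_cases h : v = r
  · subst h
    simp only [true_or, iff_true]
    exact ⟨1, fun h => (Reach.of_hasSignedPath h).1 rfl⟩
  · simp [h, hasSignedPath_iff hr h]

theorem isUndirectable_iff {r : α} (hr : r ∈ V(B.graph)) {d : B.OrientedEdge} :
    B.IsUndirectable r d.edge ↔
      B.Reach r d.tail (-d.tailSign) ∧ B.Reach r d.head (-d.headSign) := by
  simp only [IsUndirectable, hasAlmostPath_iff hr]
  constructor
  · rintro ⟨-, h⟩
    exact ⟨h d rfl, h d.rev rfl⟩
  · rintro ⟨h₁, h₂⟩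
    refine ⟨d.isLink.edge_mem, fun d' h => ?_⟩
    rcases OrientedEdge.eq_or_eq_rev h with rfl | rfl
    exacts [h₁, h₂]

theorem isNaturalOrientation_iff {r : α} (hr : r ∈ V(B.graph)) {d : B.OrientedEdge} :
    B.IsNaturalOrientation r d ↔
      B.Reach r d.tail (-d.tailSign) ∧ ¬ B.Reach r d.head (-d.headSign) := by
  simp only [IsNaturalOrientation, hasAlmostPath_iff hr]
  refine and_congr_right fun h₁ => ⟨fun h h' => d.rev_ne (h d.rev rfl h'), fun h d' he h' => ?_⟩
  rcases OrientedEdge.eq_or_eq_rev he with rfl | rfl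
  exacts [rfl, absurd h' h]

theorem mem_undirectableClass_symm {r v w : α}
    (h : w ∈ B.undirectableClass r v) : v ∈ B.undirectableClass r w := by
  have : Std.Symm fun a b => ∃ e, B.IsUndirectable r e ∧ B.graph.IsLink e a b :=
    ⟨fun _ _ ⟨e, he, hl⟩ => ⟨e, he, hl.symm⟩⟩
  exact Relation.ReflTransGen.stdSymm.symm _ _ h

theorem mem_undirectableClass_trans {r u v w : α}
    (h : v ∈ B.undirectableClass r u) (h' : w ∈ B.undirectableClass r v) :
    w ∈ B.undirectableClass r u :=
  Relation.ReflTransGen.trans h h'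

theorem eq_or_exists_isUndirectable {r v w : α}
    (h : w ∈ B.undirectableClass r v) :
    w = v ∨ ∃ d : B.OrientedEdge, B.IsUndirectable r d.edge ∧ d.tail = w := by
  rcases Relation.ReflTransGen.cases_tail h with h | ⟨u, -, e, he, hl⟩
  · exact Or.inl h
  · exact Or.inr ⟨⟨e, _, _, hl.symm⟩, he, rfl⟩

namespace IsCleanRooted

variable {r : α}

theorem closed_eq_nil {L : List B.OrientedEdge} {a s : ℤˣ} (hB : B.IsCleanRooted r)
    (h : IsWalk L r a r s) (hn : (L.map OrientedEdge.tail).Nodup) : L = [] :=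
  hB.clean (h.toTrail hB.root_mem hn)
    (Or.inr (show (r :: L.map OrientedEdge.head).dropLast.Nodup from h.dropLast_eq ▸ hn)) rfl
    h.getLast_eq

/-- Such a path followed by `d.rev` would be a nontrivial almost path from `r` to `r`. In particular
no undirectable edge meets the root. -/
theorem not_reach_of_tail_eq (hB : B.IsCleanRooted r) {d : B.OrientedEdge} (hd : d.tail = r) :
    ¬ B.Reach r d.head (-d.headSign) := by
  rintro ⟨a, L, hw, hn⟩
  have hw' : IsWalk (L ++ [d.rev]) r a r d.tailSign :=
    hw.append (isWalk_singleton.2 ⟨rfl, by simp, hd, rfl⟩)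
  have := hB.closed_eq_nil hw' (by rw [← hw.tails_append] at hn; simpa using hn)
  simp at this

theorem tail_ne_of_isUndirectable (hB : B.IsCleanRooted r) {d : B.OrientedEdge}
    (hd : B.IsUndirectable r d.edge) : d.tail ≠ r := fun h =>
  hB.not_reach_of_tail_eq h ((isUndirectable_iff hB.root_mem).1 hd).2

/-- Induction along the path: a new vertex reachable with one sign only is itself a base. Otherwise
a second path to it arrives with the other sign, and `exists_inBlob` applies to the last edge. -/
theorem exists_inBlob_of_reach (hB : B.IsCleanRooted r) {v : α} {s : ℤˣ} (h : B.Reach r v s) :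
    ∃ b, B.InBlob r b v := by
  obtain ⟨a, L, hw, hn⟩ := h
  suffices ∀ w ∈ r :: L.map OrientedEdge.head, ∃ b, B.InBlob r b w from this v hw.finish_mem
  induction L using List.reverseRecOn generalizing v s with
  | nil => simpa using ⟨r, Or.inl ⟨rfl, rfl⟩⟩
  | append_singleton L d ih =>
    obtain ⟨hw', rfl, rfl⟩ := hw.eq_of_eq_concat
    have hn' : (r :: L.map OrientedEdge.head).Nodup := by
      rw [List.map_append, ← List.cons_append] at hn
      exact hn.of_append_left
    have hL := ih hw' hn'
    intro w hw₁
    rw [List.map_append, ← List.cons_append, List.mem_append] at hw₁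
    rcases hw₁ with hw₁ | hw₁
    · exact hL w hw₁
    obtain rfl : w = d.head := by simpa using hw₁
    by_cases h : B.Reach r d.head (-d.headSign)
    · obtain ⟨a', Q, hQ, hQn⟩ := h
      obtain ⟨b, -, hb⟩ := exists_inBlob (fun L a s h hn => hB.closed_eq_nil h hn) hw' hQ (by simp)
        (by simp) hn' hQn hL
      exact ⟨b, hb⟩
    · exact ⟨d.head, Or.inr ⟨_, _, ⟨⟨a, _, hw, hn⟩, h⟩, isBlob_singleton _ _, rfl⟩⟩

theorem exists_inBlob_of_isUndirectable (hB : B.IsCleanRooted r) {d : B.OrientedEdge}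
    (hd : B.IsUndirectable r d.edge) : ∃ b, B.InBlob r b d.tail ∧ B.InBlob r b d.head := by
  obtain ⟨⟨a₁, P, hP, hPn⟩, a₂, Q, hQ, hQn⟩ := (isUndirectable_iff hB.root_mem).1 hd
  refine exists_inBlob (fun L a s h hn => hB.closed_eq_nil h hn) hP hQ (by simp) (by simp) hPn hQn
    fun w hw => ?_
  obtain ⟨A, C, w', t, rfl, hA, -, rfl, -⟩ := hP.exists_first (· = w) ⟨w, hw, rfl⟩
  exact hB.exists_inBlob_of_reach (Reach.of_isWalk_append hA hPn)

theorem eq_of_inBlob_plain (hB : B.IsCleanRooted r) {b v : α} (h : B.InBlob r b v)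
    (hv : v ∈ B.plainVertices r) : b = v := by
  rcases ((mem_plainVertices_iff hB.root_mem).1 hv).2 with rfl | ⟨s, hs⟩
  · exact h.unique (Or.inl ⟨rfl, rfl⟩)
  · by_contra hne
    exact hs (h.reach (Ne.symm hne) s)

theorem inBlob_of_mem_undirectableClass (hB : B.IsCleanRooted r) {b v w : α}
    (h : B.InBlob r b v) (hw : w ∈ B.undirectableClass r v) : B.InBlob r b w := by
  induction hw with
  | refl => exact h
  | tail _ hl ih =>
    obtain ⟨e, he, hl⟩ := hl
    obtain ⟨b', h₁, h₂⟩ := hB.exists_inBlob_of_isUndirectable (d := ⟨e, _, _, hl⟩) he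
    rwa [ih.unique h₁]

/-- Uniqueness holds because the whole class lies in one blob, and a plain vertex of a blob is its
base. A vertex on no undirectable edge has a one-element class and is fixed by the default value. -/
theorem contract_eq (hB : B.IsCleanRooted r) {v c : α} (hc : c ∈ B.plainVertices r)
    (hcv : c ∈ B.undirectableClass r v) : B.contract r v = c := by
  by_cases hv : ∃ d : B.OrientedEdge, B.IsUndirectable r d.edge ∧ d.tail = v
  · obtain ⟨d, hd, rfl⟩ := hv
    obtain ⟨b, hb, -⟩ := hB.exists_inBlob_of_isUndirectable hd
    have huniq : ∀ c', (∃ C, B.IsUndirectableComponent r C ∧ d.tail ∈ C ∧ c' ∈ C ∧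
        c' ∈ B.plainVertices r ∪ {r}) → c' = c := by
      rintro c' ⟨_, ⟨v', -, rfl⟩, h₁, h₂, h₃⟩
      have hc' : c' ∈ B.plainVertices r := by
        rcases h₃ with h₃ | rfl
        · exact h₃
        · exact (mem_plainVertices_iff hB.root_mem).2 ⟨hB.root_mem, Or.inl rfl⟩
      have h₄ := mem_undirectableClass_trans (mem_undirectableClass_symm h₁) h₂
      rw [← hB.eq_of_inBlob_plain (hB.inBlob_of_mem_undirectableClass hb hcv) hc,
        hB.eq_of_inBlob_plain (hB.inBlob_of_mem_undirectableClass hb h₄) hc']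
    have hex : ∃! c, ∃ C, B.IsUndirectableComponent r C ∧ d.tail ∈ C ∧ c ∈ C ∧
        c ∈ B.plainVertices r ∪ {r} :=
      ⟨c, ⟨_, ⟨d.tail, ⟨d.edge, hd, d.isLink.inc_left⟩, rfl⟩, Relation.ReflTransGen.refl, hcv,
        Or.inl hc⟩, huniq⟩
    rw [contract, dif_pos hex]
    exact huniq _ hex.choose_spec.1
  · have hne : ¬ ∃! c, ∃ C, B.IsUndirectableComponent r C ∧ v ∈ C ∧ c ∈ C ∧
        c ∈ B.plainVertices r ∪ {r} := by
      rintro ⟨c', ⟨_, ⟨v', ⟨e, he, hinc⟩, rfl⟩, h₁, -⟩, -⟩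
      rcases eq_or_exists_isUndirectable h₁ with rfl | h₁
      · obtain ⟨w, hl⟩ := hinc
        exact hv ⟨⟨e, _, _, hl⟩, he, rfl⟩
      · exact hv h₁
    rw [contract, dif_neg hne]
    exact (eq_or_exists_isUndirectable (mem_undirectableClass_symm hcv)).resolve_right hv

/-- The path up to `d` reaches its tail with the right sign. A head that is not plain is reachable
with both signs, hence also with the one that lets `d.rev` follow. -/
theorem isUndirectable_of_mem_path (hB : B.IsCleanRooted r) {L : List B.OrientedEdge} {v : α}
    {a s : ℤˣ} (h : IsWalk L r a v s) (hn : (r :: L.map OrientedEdge.head).Nodup)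
    {d : B.OrientedEdge} (hd : d ∈ L) (hp : d.head ∉ B.plainVertices r) :
    B.IsUndirectable r d.edge := by
  obtain ⟨A, C, rfl⟩ := List.append_of_mem hd
  have := (mem_plainVertices_iff hB.root_mem).not.1 hp
  push Not at this
  exact (isUndirectable_iff hB.root_mem).2 ⟨Reach.of_isWalk_append h.split.1 hn,
    (this d.isLink.right_mem).2 _⟩

theorem isNaturalOrientation_of_mem_path (hB : B.IsCleanRooted r) {L : List B.OrientedEdge}
    {v : α} {a s : ℤˣ} (h : IsWalk L r a v s) (hn : (r :: L.map OrientedEdge.head).Nodup)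
    {d : B.OrientedEdge} (hd : d ∈ L) (hp : d.head ∈ B.plainVertices r) :
    B.IsNaturalOrientation r d := by
  obtain ⟨A, C, rfl⟩ := List.append_of_mem hd
  refine (isNaturalOrientation_iff hB.root_mem).2 ⟨Reach.of_isWalk_append h.split.1 hn,
    fun h' => ?_⟩
  rcases ((mem_plainVertices_iff hB.root_mem).1 hp).2 with h₁ | ⟨s, hs⟩
  · rw [← h₁] at hn
    simp at hn
  · have hr : B.Reach r d.head d.headSign :=
      Reach.of_isWalk_append h.split.2.1 (C := C) (by simpa using hn)
    rcases sign_eq_or_eq_neg s d.headSign with rfl | rfl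
    exacts [hs hr, hs h']

/-- Every path from the root splits at its last plain vertex; the rest of it consists of
undirectable edges. -/
theorem exists_last_plain (hB : B.IsCleanRooted r) {L : List B.OrientedEdge} {v : α}
    {a s : ℤˣ} (h : IsWalk L r a v s) (hn : (r :: L.map OrientedEdge.head).Nodup) :
    ∃ A C c t, L = A ++ C ∧ IsWalk A r a c t ∧ IsWalk C c t v s ∧ c ∈ B.plainVertices r ∧
      ∀ w ∈ c :: C.map OrientedEdge.head, w ∈ B.undirectableClass r c := by
  obtain ⟨A, C, c, t, rfl, hA, hC, hc, hlast⟩ := h.exists_last (· ∈ B.plainVertices r)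
    ⟨r, by simp, (mem_plainVertices_iff hB.root_mem).2 ⟨hB.root_mem, Or.inl rfl⟩⟩
  refine ⟨A, C, c, t, rfl, hA, hC, hc, ?_⟩
  have hund : ∀ d ∈ C, B.IsUndirectable r d.edge := fun d hd =>
    hB.isUndirectable_of_mem_path h hn (List.mem_append_right _ hd)
      (hlast _ (List.mem_map_of_mem hd))
  clear hlast hA h hn hc
  induction C generalizing c t with
  | nil => exact List.forall_mem_singleton.2 Relation.ReflTransGen.refl
  | cons d C ih =>
    obtain ⟨rfl, -, hC⟩ := hC
    have hd : d.head ∈ B.undirectableClass r d.tail :=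
      Relation.ReflTransGen.single ⟨d.edge, hund d (by simp), d.isLink⟩
    refine List.forall_mem_cons.2 ⟨Relation.ReflTransGen.refl, fun w hw => ?_⟩
    exact mem_undirectableClass_trans hd
      (ih _ _ hC (fun d hd => hund d (List.mem_cons_of_mem _ hd)) w hw)

theorem exists_plain_mem_undirectableClass (hB : B.IsCleanRooted r) {v : α}
    (hv : v ∈ V(B.graph)) : ∃ c ∈ B.plainVertices r, c ∈ B.undirectableClass r v := by
  by_cases hp : v ∈ B.plainVertices r
  · exact ⟨v, hp, Relation.ReflTransGen.refl⟩
  · have := (mem_plainVertices_iff hB.root_mem).not.1 hp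
    push Not at this
    obtain ⟨a, L, hw, hn⟩ := (this hv).2 1
    obtain ⟨A, C, c, t, rfl, -, hC, hc, hcl⟩ := hB.exists_last_plain hw hn
    exact ⟨c, hc, mem_undirectableClass_symm (hcl v hC.finish_mem)⟩

theorem contract_mem_plainVertices (hB : B.IsCleanRooted r) {v : α} (hv : v ∈ V(B.graph)) :
    B.contract r v ∈ B.plainVertices r := by
  obtain ⟨c, hc, hcv⟩ := hB.exists_plain_mem_undirectableClass hv
  rwa [hB.contract_eq hc hcv]

theorem contract_of_plain (hB : B.IsCleanRooted r) {v : α} (hv : v ∈ B.plainVertices r) :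
    B.contract r v = v :=
  hB.contract_eq hv Relation.ReflTransGen.refl

theorem contract_root (hB : B.IsCleanRooted r) : B.contract r r = r :=
  hB.contract_of_plain ((mem_plainVertices_iff hB.root_mem).2 ⟨hB.root_mem, Or.inl rfl⟩)

theorem eq_root_of_contract_eq (hB : B.IsCleanRooted r) {v : α} (hv : v ∈ V(B.graph))
    (h : B.contract r v = r) : v = r := by
  obtain ⟨c, hc, hcv⟩ := hB.exists_plain_mem_undirectableClass hv
  rw [hB.contract_eq hc hcv] at h
  subst h
  rcases eq_or_exists_isUndirectable hcv with h | ⟨d, hd, h⟩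
  · exact h.symm
  · exact absurd h (hB.tail_ne_of_isUndirectable hd)

theorem contract_eq_of_isUndirectable (hB : B.IsCleanRooted r) {d : B.OrientedEdge}
    (hd : B.IsUndirectable r d.edge) : B.contract r d.tail = B.contract r d.head := by
  obtain ⟨c, hc, hcv⟩ := hB.exists_plain_mem_undirectableClass d.isLink.right_mem
  rw [hB.contract_eq hc hcv]
  exact hB.contract_eq hc (mem_undirectableClass_trans
    (Relation.ReflTransGen.single ⟨d.edge, hd, d.isLink⟩) hcv)

theorem mem_vertexSet_skeleton (hB : B.IsCleanRooted r) {v : α} :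
    v ∈ (B.skeleton r).vertexSet ↔ v ∈ B.plainVertices r := by
  constructor
  · rintro ⟨w, hw, rfl⟩
    exact hB.contract_mem_plainVertices hw
  · exact fun hv => ⟨v, hv.1, hB.contract_of_plain hv⟩

/-- The part of a root path after its last plain vertex starts at the vertex onto which its end is
contracted, and all of its vertices are contracted onto that vertex. -/
theorem exists_last_plain_contract (hB : B.IsCleanRooted r) {L : List B.OrientedEdge} {v : α}
    {a s : ℤˣ} (h : IsWalk L r a v s) (hn : (r :: L.map OrientedEdge.head).Nodup) :
    ∃ A C t, L = A ++ C ∧ IsWalk A r a (B.contract r v) t ∧ IsWalk C (B.contract r v) t v s ∧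
      ∀ w ∈ C.map OrientedEdge.head, B.contract r w = B.contract r v := by
  obtain ⟨A, C, c, t, rfl, hA, hC, hc, hcl⟩ := hB.exists_last_plain h hn
  have hcl' : ∀ w ∈ c :: C.map OrientedEdge.head, B.contract r w = c := fun w hw =>
    hB.contract_eq hc (mem_undirectableClass_symm (hcl w hw))
  have hv := hcl' v hC.finish_mem
  rw [hv]
  exact ⟨A, C, t, rfl, hA, hC, fun w hw => hcl' w (List.mem_cons_of_mem _ hw)⟩

/-- The almost path to `d` might revisit its own head, so path-reachability is needed: it yields a
path ending in `d` or `d.rev`, and the natural orientation excludes `d.rev`. -/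
theorem reach_head (hB : B.IsCleanRooted r) {d : B.OrientedEdge}
    (hd : B.IsNaturalOrientation r d) : B.Reach r d.head d.headSign := by
  obtain ⟨T, hT, hTr, d', hd', he⟩ := hB.pathReachable d.edge d.isLink.edge_mem
  obtain ⟨a, L, hL, hw, hw'⟩ := hd'.exists_isWalk
  rw [hTr] at hw hw'
  rw [Trail.IsPath, Trail.vertices, hTr] at hT
  rcases OrientedEdge.eq_or_eq_rev he with rfl | rfl
  · exact ⟨a, _, hw, hT⟩
  · rw [hL] at hT
    exact absurd (Reach.of_isWalk_append hw' hT) ((isNaturalOrientation_iff hB.root_mem).1 hd).2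

theorem head_mem_plainVertices (hB : B.IsCleanRooted r) {d : B.OrientedEdge}
    (hd : B.IsNaturalOrientation r d) : d.head ∈ B.plainVertices r :=
  (mem_plainVertices_iff hB.root_mem).2 ⟨d.isLink.right_mem,
    Or.inr ⟨_, ((isNaturalOrientation_iff hB.root_mem).1 hd).2⟩⟩

theorem isBase_head (hB : B.IsCleanRooted r) {d : B.OrientedEdge}
    (hd : B.IsNaturalOrientation r d) : B.IsBase r d.head d.headSign :=
  ⟨hB.reach_head hd, ((isNaturalOrientation_iff hB.root_mem).1 hd).2⟩

end IsCleanRooted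

end BidirectedGraph

/-! ### Comparing maximum disjoint families -/

theorem List.mem_dropLast_iff_of_nodup_cons {α : Type*} {l : List α} {r x w : α}
    (hn : (r :: l).Nodup) (hx : (r :: l).getLast (List.cons_ne_nil _ _) = x) (hne : x ≠ r) :
    w ∈ l.dropLast ↔ w ∈ r :: l ∧ w ≠ r ∧ w ≠ x := by
  rcases List.eq_nil_or_concat l with rfl | ⟨m, y, rfl⟩
  · exact absurd hx.symm hne
  · simp only [List.concat_eq_append] at hn hx ⊢
    obtain rfl : y = x := by simpa using hx
    simp only [List.nodup_cons, List.nodup_append, List.mem_append] at hn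
    simp only [List.dropLast_concat, List.mem_cons, List.mem_append, List.not_mem_nil, or_false]
    constructor
    · exact fun h => ⟨Or.inr (Or.inl h), fun h' => hn.1 (Or.inl (h' ▸ h)),
        hn.2.2.2 w h y (by simp)⟩
    · rintro ⟨h | h | h, h₁, h₂⟩
      exacts [absurd h h₁, h, absurd h h₂]

/-- The conclusion `p' ≠ q'` in `hdis` is essential: objects without internal vertices are disjoint
even from themselves, so disjointness does not make the choice of partners injective. -/
theorem maxInternallyDisjoint_le {α γ γ' : Type*} {S : Set γ} {S' : Set γ'} {i : γ → List α}
    {i' : γ' → List α} (R : γ → γ' → Prop) (hR : ∀ p ∈ S, ∃ q ∈ S', R p q)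
    (hdis : ∀ p ∈ S, ∀ q ∈ S, ∀ p' ∈ S', ∀ q' ∈ S', R p p' → R q q' → p ≠ q →
      (i p).Disjoint (i q) → p' ≠ q' ∧ (i' p').Disjoint (i' q')) :
    maxInternallyDisjoint S i ≤ maxInternallyDisjoint S' i' := by
  refine iSup₂_le fun P hP => ?_
  obtain ⟨hPS, hPd⟩ := hP
  rcases P.eq_empty_or_nonempty with rfl | ⟨p₀, hp₀⟩
  · simp
  have : Nonempty γ' := ⟨(hR p₀ (hPS hp₀)).choose⟩
  choose! f hfS hfR using hR
  have key : ∀ p ∈ P, ∀ q ∈ P, p ≠ q → f p ≠ f q ∧ (i' (f p)).Disjoint (i' (f q)) :=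
    fun p hp q hq hne => hdis p (hPS hp) q (hPS hq) _ (hfS p (hPS hp)) _ (hfS q (hPS hq))
      (hfR p (hPS hp)) (hfR q (hPS hq)) hne (hPd hp hq hne)
  have hinj : Set.InjOn f P := fun p hp q hq h => by
    by_contra hne
    exact (key p hp q hq hne).1 h
  rw [← hinj.encard_image]
  refine le_iSup₂_of_le (f '' P) ⟨?_, ?_⟩ le_rfl
  · rintro _ ⟨p, hp, rfl⟩
    exact hfS p (hPS hp)
  · rintro _ ⟨p, hp, rfl⟩ _ ⟨q, hq, rfl⟩ hne
    exact (key p hp q hq fun h => hne (congrArg f h)).2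

/-! ### Directed walks -/

namespace DirectedMultigraph

variable {α β : Type*} {D : DirectedMultigraph α β}

/-- The arcs in a list form a directed walk between the given vertices. -/
def IsWalk : List D.Arc → α → α → Prop
  | [], u, v => u = v
  | e :: E, u, v => e.tail = u ∧ IsWalk E e.head v

theorem IsWalk.tail_first {E : List D.Arc} {u v : α} (h : IsWalk E u v) :
    ∀ e ∈ E.head?, e.tail = u := by
  cases E with
  | nil => simp
  | cons e E => simpa using h.1

theorem IsWalk.isChain {E : List D.Arc} {u v : α} (h : IsWalk E u v) :
    E.IsChain fun e e' => e'.tail = e.head := by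
  induction E generalizing u with
  | nil => exact .nil
  | cons e E ih => exact List.isChain_cons.2 ⟨h.2.tail_first, ih h.2⟩

theorem IsWalk.getLast_eq {E : List D.Arc} {u v : α} (h : IsWalk E u v) :
    (u :: E.map Arc.head).getLast (List.cons_ne_nil _ _) = v := by
  induction E generalizing u with
  | nil => exact h
  | cons e E ih => simpa using ih h.2

theorem IsWalk.mem_heads {e : D.Arc} {E : List D.Arc} {u v : α} (h : IsWalk (e :: E) u v) :
    v ∈ (e :: E).map Arc.head := by
  rw [List.map_cons, ← h.2.getLast_eq]
  exact List.getLast_mem _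

theorem isWalk_of_isChain {E : List D.Arc} {u : α} (h₁ : ∀ e ∈ E.head?, e.tail = u)
    (h₂ : E.IsChain fun e e' => e'.tail = e.head) :
    IsWalk E u ((u :: E.map Arc.head).getLast (List.cons_ne_nil _ _)) := by
  induction E generalizing u with
  | nil => rfl
  | cons e E ih =>
    have h₂' := List.isChain_cons.1 h₂
    exact ⟨h₁ e rfl, by simpa using ih h₂'.1 h₂'.2⟩

theorem DirectedPath.isWalk (P : D.DirectedPath) : IsWalk P.steps P.start P.finish :=
  isWalk_of_isChain P.tail_first P.chain

theorem DirectedPath.mem_internalVertices_iff {P : D.DirectedPath} {r x w : α}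
    (hr : P.start = r) (hx : P.finish = x) (hne : x ≠ r) :
    w ∈ P.internalVertices ↔ w ∈ P.vertices ∧ w ≠ r ∧ w ≠ x := by
  subst hr
  exact List.mem_dropLast_iff_of_nodup_cons P.vertices_nodup hx hne

end DirectedMultigraph

/-! ### Projecting root paths to the skeleton -/

namespace BidirectedGraph

variable {α β : Type*} {B : BidirectedGraph α β} {r : α}

theorem Trail.mem_internalVertices_iff {T : B.Trail} {x w : α} (hT : T.IsPath)
    (hr : T.start = r) (hx : T.finish = x) (hne : x ≠ r) :
    w ∈ T.internalVertices ↔ w ∈ T.vertices ∧ w ≠ r ∧ w ≠ x := by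
  subst hr
  exact List.mem_dropLast_iff_of_nodup_cons hT hx hne

/-- The arc of the skeleton given by a naturally oriented edge. -/
noncomputable def arcOf (d : B.OrientedEdge) (h : B.IsNaturalOrientation r d) :
    (B.skeleton r).Arc :=
  ⟨d.edge, B.contract r d.tail, B.contract r d.head, d, h, rfl, rfl, rfl⟩

open Classical in
variable (r) in
/-- The arcs of the skeleton given by the naturally oriented edges in a list. -/
noncomputable def arcs (L : List B.OrientedEdge) : List (B.skeleton r).Arc :=
  L.filterMap fun d => if h : B.IsNaturalOrientation r d then some (arcOf d h) else none

theorem arcs_append (L M : List B.OrientedEdge) : arcs r (L ++ M) = arcs r L ++ arcs r M :=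
  List.filterMap_append

theorem arcs_cons_of_natural {d : B.OrientedEdge} (h : B.IsNaturalOrientation r d)
    (L : List B.OrientedEdge) : arcs r (d :: L) = arcOf d h :: arcs r L := by
  simp [arcs, h]

theorem arcs_cons_of_not_natural {d : B.OrientedEdge} (h : ¬ B.IsNaturalOrientation r d)
    (L : List B.OrientedEdge) : arcs r (d :: L) = arcs r L := by
  simp [arcs, h]

theorem arcs_eq_nil {L : List B.OrientedEdge} (h : ∀ d ∈ L, ¬ B.IsNaturalOrientation r d) :
    arcs r L = [] := by
  induction L with
  | nil => rfl
  | cons d L ih =>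
    rw [arcs_cons_of_not_natural (h d (by simp)), ih fun d' hd' => h d' (List.mem_cons_of_mem _ hd')]

namespace IsCleanRooted

theorem isWalk_arcs (hB : B.IsCleanRooted r) {L : List B.OrientedEdge} {u v : α} {a s : ℤˣ}
    (h : IsWalk L u a v s)
    (hL : ∀ d ∈ L, B.IsNaturalOrientation r d ∨ B.IsUndirectable r d.edge) :
    DirectedMultigraph.IsWalk (arcs r L) (B.contract r u) (B.contract r v) := by
  induction L generalizing u a with
  | nil => exact congrArg _ h.1
  | cons d L ih =>
    obtain ⟨rfl, -, h⟩ := h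
    have ih' := ih h fun d' hd' => hL d' (List.mem_cons_of_mem _ hd')
    by_cases hd : B.IsNaturalOrientation r d
    · rw [arcs_cons_of_natural hd]
      exact ⟨rfl, ih'⟩
    · rw [arcs_cons_of_not_natural hd,
        hB.contract_eq_of_isUndirectable ((hL d (by simp)).resolve_left hd)]
      exact ih'

theorem heads_arcs_sublist (hB : B.IsCleanRooted r) (L : List B.OrientedEdge) :
    ((arcs r L).map DirectedMultigraph.Arc.head).Sublist (L.map OrientedEdge.head) := by
  induction L with
  | nil => exact List.Sublist.slnil
  | cons d L ih =>
    by_cases hd : B.IsNaturalOrientation r d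
    · rw [arcs_cons_of_natural hd, List.map_cons, List.map_cons,
        show (arcOf d hd).head = d.head from
          hB.contract_of_plain (hB.head_mem_plainVertices hd)]
      exact ih.cons_cons _
    · rw [arcs_cons_of_not_natural hd]
      exact ih.cons _

theorem natural_or_isUndirectable (hB : B.IsCleanRooted r) {L : List B.OrientedEdge} {v : α}
    {a s : ℤˣ} (h : IsWalk L r a v s) (hn : (r :: L.map OrientedEdge.head).Nodup)
    (d : B.OrientedEdge) (hd : d ∈ L) :
    B.IsNaturalOrientation r d ∨ B.IsUndirectable r d.edge := by
  by_cases hp : d.head ∈ B.plainVertices r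
  · exact Or.inl (hB.isNaturalOrientation_of_mem_path h hn hd hp)
  · exact Or.inr (hB.isUndirectable_of_mem_path h hn hd hp)

theorem root_mem_plainVertices (hB : B.IsCleanRooted r) : r ∈ B.plainVertices r :=
  (mem_plainVertices_iff hB.root_mem).2 ⟨hB.root_mem, Or.inl rfl⟩

/-- A path from the root to a plain vertex projects onto a directed path of the skeleton. -/
theorem exists_directedPath (hB : B.IsCleanRooted r) {T : B.Trail} (hT : T.IsPath)
    (hr : T.start = r) (hx : T.finish ∈ B.plainVertices r) :
    ∃ P : (B.skeleton r).DirectedPath, P.start = r ∧ P.finish = T.finish ∧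
      P.steps = arcs r T.steps := by
  obtain ⟨a, s, hw⟩ := T.exists_isWalk
  rw [Trail.IsPath, Trail.vertices] at hT
  rw [hr] at hw hT
  have h := hB.isWalk_arcs hw (hB.natural_or_isUndirectable hw hT)
  rw [hB.contract_root, hB.contract_of_plain hx] at h
  exact ⟨⟨r, arcs r T.steps, hB.mem_vertexSet_skeleton.2 hB.root_mem_plainVertices, h.tail_first,
    h.isChain, hT.sublist ((hB.heads_arcs_sublist _).cons_cons _)⟩, rfl, h.getLast_eq, rfl⟩

/-- The first edge is natural because no undirectable edge meets `r`, the last because its head is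
plain. With at most one arc these two coincide. -/
theorem steps_eq_singleton (hB : B.IsCleanRooted r) {L : List B.OrientedEdge} {x : α}
    {a s : ℤˣ} (h : IsWalk L r a x s) (hn : (r :: L.map OrientedEdge.head).Nodup)
    (hx : x ∈ B.plainVertices r) (hxr : x ≠ r) (hlen : (arcs r L).length ≤ 1) :
    ∃ d, L = [d] ∧ B.IsNaturalOrientation r d := by
  cases L with
  | nil => exact absurd h.1.symm hxr
  | cons d L =>
    have hd : B.IsNaturalOrientation r d :=
      (hB.natural_or_isUndirectable h hn d (by simp)).resolve_right fun hd =>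
        hB.tail_ne_of_isUndirectable hd h.1
    refine ⟨d, ?_, hd⟩
    rcases List.eq_nil_or_concat L with rfl | ⟨M, f, rfl⟩
    · rfl
    · rw [List.concat_eq_append] at h hn hlen
      have hf : B.IsNaturalOrientation r f := by
        refine hB.isNaturalOrientation_of_mem_path h hn (by simp) ?_
        rw [← List.cons_append] at h
        rwa [h.eq_of_eq_concat.2.1]
      rw [arcs_cons_of_natural hd, arcs_append, arcs_cons_of_natural hf] at hlen
      simp at hlen

theorem kappa_le_skeleton (hB : B.IsCleanRooted r) {x : α} (hx : x ∈ B.plainVertices r)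
    (hxr : x ≠ r) : B.kappa r x ≤ (B.skeleton r).kappa r x := by
  refine maxInternallyDisjoint_le (fun T P => P.steps = arcs r T.steps) ?_ ?_
  · rintro T ⟨hT, hr, rfl⟩
    obtain ⟨P, h₁, h₂, h₃⟩ := hB.exists_directedPath hT hr hx
    exact ⟨P, ⟨h₁, h₂⟩, h₃⟩
  · rintro T ⟨hT, hTr, hTx⟩ T' ⟨hT', hTr', hTx'⟩ P ⟨hPr, hPx⟩ P' ⟨hPr', hPx'⟩ hP hP' hne hdis
    have hsub : ∀ (T : B.Trail) (P : (B.skeleton r).DirectedPath), T.IsPath → T.start = r →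
        T.finish = x → P.start = r → P.finish = x → P.steps = arcs r T.steps →
        ∀ w ∈ P.internalVertices, w ∈ T.internalVertices := by
      intro T P hT hTr hTx hPr hPx hP w hw
      obtain ⟨h₁, h₂⟩ := (P.mem_internalVertices_iff hPr hPx hxr).1 hw
      refine (T.mem_internalVertices_iff hT hTr hTx hxr).2 ⟨?_, h₂⟩
      refine List.mem_cons_of_mem _ ((hB.heads_arcs_sublist T.steps).subset ?_)
      rw [← hP]
      exact (List.mem_cons.1 h₁).resolve_left fun h => h₂.1 (h.trans hPr)
    refine ⟨?_, fun w hw hw' => hdis (hsub T P hT hTr hTx hPr hPx hP w hw)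
      (hsub T' P' hT' hTr' hTx' hPr' hPx' hP' w hw')⟩
    -- If two disjoint paths had the same projection, it would have no internal vertices, hence be a
    -- single arc. Both paths would then consist of the same edge.
    rintro rfl
    have hnil : P.internalVertices = [] := List.eq_nil_iff_forall_not_mem.2 fun w hw =>
      hdis (hsub T P hT hTr hTx hPr hPx hP w hw) (hsub T' P hT' hTr' hTx' hPr hPx hP' w hw)
    have hlen : P.steps.length ≤ 1 := by
      have := congrArg List.length hnil
      simp only [DirectedMultigraph.DirectedPath.internalVertices,
        DirectedMultigraph.DirectedPath.vertices, List.tail_cons, List.length_dropLast,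
        List.length_map, List.length_nil] at this
      omega
    have hsingle : ∀ T : B.Trail, T.IsPath → T.start = r → T.finish = x →
        P.steps = arcs r T.steps → ∃ d, T.steps = [d] ∧ B.IsNaturalOrientation r d := by
      intro T hT hTr hTx hP
      obtain ⟨a, s, hw⟩ := T.exists_isWalk
      rw [Trail.IsPath, Trail.vertices, hTr] at hT
      rw [hTr, hTx] at hw
      exact hB.steps_eq_singleton hw hT hx hxr (hP ▸ hlen)
    obtain ⟨d, hd, hdn⟩ := hsingle T hT hTr hTx hP
    obtain ⟨d', hd', hdn'⟩ := hsingle T' hT' hTr' hTx' hP'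
    have harc := hP.symm.trans hP'
    rw [hd, hd', arcs_cons_of_natural hdn, arcs_cons_of_natural hdn'] at harc
    have he : d.edge = d'.edge :=
      congrArg DirectedMultigraph.Arc.edge (List.cons.inj harc).1
    obtain rfl := hdn'.2 d he hdn.1
    exact hne (Trail.ext (hTr.trans hTr'.symm) (hd.trans hd'.symm))

/-! ### Lifting directed paths -/

/-- A directed walk without repeated vertices in the skeleton lifts to a path. -/
theorem exists_lift (hB : B.IsCleanRooted r) {E : List (B.skeleton r).Arc} {c x : α}
    (hE : DirectedMultigraph.IsWalk E c x)
    (hn : (c :: E.map DirectedMultigraph.Arc.head).Nodup) :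
    ∃ (L : List B.OrientedEdge) (t s : ℤˣ), IsWalk L c t x s ∧
      (c :: L.map OrientedEdge.head).Nodup ∧ (∀ a, B.IsBase r c a → t = a) ∧ arcs r L = E ∧
      ∀ w ∈ L.map OrientedEdge.head, B.contract r w ∈ c :: E.map DirectedMultigraph.Arc.head ∧
        (B.contract r w = x → w = x) := by
  induction E generalizing c with
  | nil =>
    -- The sign of an empty lift matters only at a base; elsewhere `1` is an arbitrary choice.
    obtain ⟨t, ht⟩ : ∃ t, ∀ a, B.IsBase r c a → t = a := by
      by_cases h : ∃ a, B.IsBase r c a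
      · obtain ⟨t, ht⟩ := h
        exact ⟨t, fun a ha => ha.sign_eq ht.1⟩
      · exact ⟨1, fun a ha => absurd ⟨a, ha⟩ h⟩
    exact ⟨[], t, t, ⟨hE, rfl⟩, by simp, ht, rfl, by simp⟩
  | cons e E ih =>
    have hxE := hE.mem_heads
    obtain ⟨rfl, hE⟩ := hE
    rw [List.map_cons] at hn
    obtain ⟨L', t', s, hL', hLn', ht', rfl, hheads⟩ := ih hE hn.of_cons
    obtain ⟨d, hd, he, htail, hhead⟩ := e.isArc
    have hdp := hB.contract_of_plain (hB.head_mem_plainVertices hd)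
    have harc : arcOf d hd = e := DirectedMultigraph.Arc.ext he htail hhead
    rw [hdp] at hhead
    rw [← hhead] at hL' hLn' ht' hheads
    -- The remaining lift starts with the only sign with which `d.head` is reachable, which is the
    -- sign with which `d` arrives.
    obtain rfl := ht' _ (hB.isBase_head hd)
    obtain ⟨a, Q, hQ, hQn⟩ := ((isNaturalOrientation_iff hB.root_mem).1 hd).1
    -- Only `C`, which leads from `e.tail` to `d.tail` inside one class, enters the lift. `A`
    -- witnesses that `e.tail` is reachable with sign `t`, so `t` is the forced sign if `e.tail` is
    -- a base.
    obtain ⟨A, C, t, rfl, hA, hC, hcl⟩ := hB.exists_last_plain_contract hQ hQn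
    rw [htail] at hA hC hcl
    have hCn : (e.tail :: C.map OrientedEdge.head).Nodup := by
      rw [List.map_append, ← List.cons_append, ← hA.tails_append, List.append_assoc] at hQn
      exact hQn.of_append_right
    have hcl' : ∀ w ∈ e.tail :: C.map OrientedEdge.head, B.contract r w = e.tail := by
      refine List.forall_mem_cons.2 ⟨?_, hcl⟩
      rw [← htail]
      exact hB.contract_of_plain (hB.contract_mem_plainVertices d.isLink.left_mem)
    have hrest : ∀ w ∈ d.head :: L'.map OrientedEdge.head,
        B.contract r w ∈ (e :: arcs r L').map DirectedMultigraph.Arc.head ∧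
          (B.contract r w = x → w = x) := by
      refine List.forall_mem_cons.2 ⟨⟨?_, fun h => hdp ▸ h⟩, fun w hw => ?_⟩
      · rw [hdp, hhead]; simp
      · rw [List.map_cons, ← hhead]
        exact hheads w hw
    -- The head of a natural edge is fixed by the contraction, so on `C` it would be a second visit
    -- to `e.tail`.
    have hnatC : arcs r C = [] := by
      refine arcs_eq_nil fun f hf hfn => ?_
      have hfC := List.mem_map_of_mem (f := OrientedEdge.head) hf
      have := hcl _ hfC
      rw [hB.contract_of_plain (hB.head_mem_plainVertices hfn)] at this
      exact (List.nodup_cons.1 hCn).1 (this ▸ hfC)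
    have hdC : IsWalk (C ++ d :: L') e.tail t x s :=
      hC.append ⟨rfl, by simp, hL'⟩
    refine ⟨C ++ d :: L', t, s, hdC, ?_, ?_, ?_, ?_⟩
    · rw [List.map_append, ← List.cons_append, List.map_cons, List.nodup_append]
      refine ⟨hCn, hLn', ?_⟩
      rintro w hw w' hw' rfl
      have := (hrest w hw').1
      rw [hcl' w hw] at this
      exact (List.nodup_cons.1 hn).1 this
    · exact fun a ha => ha.sign_eq (Reach.of_isWalk_append hA hQn)
    · rw [arcs_append, hnatC, List.nil_append, arcs_cons_of_natural hd, harc]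
    · intro w hw
      rw [List.map_append, List.mem_append] at hw
      rcases hw with hw | hw
      · rw [hcl w hw]
        refine ⟨by simp, fun h => ?_⟩
        exact absurd (h ▸ hxE) (List.nodup_cons.1 hn).1
      · exact ⟨List.mem_cons_of_mem _ (hrest w hw).1, (hrest w hw).2⟩

/-- The contraction maps internal vertices of a lift to internal vertices of the directed path: only
`r` contracts onto `r`, and a lift meets the fibre of `x` in `x` alone. Distinct directed paths have
distinct lifts because `arcs` recovers the path. -/
theorem skeleton_kappa_le (hB : B.IsCleanRooted r) {x : α} (hxr : x ≠ r) :
    (B.skeleton r).kappa r x ≤ B.kappa r x := by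
  refine maxInternallyDisjoint_le (fun P T => arcs r T.steps = P.steps ∧
    ∀ w ∈ T.steps.map OrientedEdge.head, B.contract r w ∈ P.vertices ∧
        (B.contract r w = x → w = x)) ?_ ?_
  · rintro P ⟨hPr, hPx⟩
    obtain ⟨L, t, s, hL, hn, -, harcs, hheads⟩ := hB.exists_lift P.isWalk P.vertices_nodup
    rw [hPr] at hL hn
    rw [hPx] at hL hheads
    exact ⟨hL.toTrail hB.root_mem (hL.tails_nodup hn), ⟨hn, rfl, hL.getLast_eq⟩, harcs, hheads⟩
  · rintro P ⟨hPr, hPx⟩ P' ⟨hPr', hPx'⟩ T ⟨hT, hTr, hTx⟩ T' ⟨hT', hTr', hTx'⟩ ⟨hP, hPT⟩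
      ⟨hP', hPT'⟩ hne hdis
    refine ⟨?_, ?_⟩
    · rintro rfl
      exact hne (DirectedMultigraph.DirectedPath.ext (hPr.trans hPr'.symm) (hP.symm.trans hP'))
    · have hsub : ∀ (T : B.Trail) (P : (B.skeleton r).DirectedPath), T.IsPath → T.start = r →
          T.finish = x → P.start = r → P.finish = x →
          (∀ w ∈ T.steps.map OrientedEdge.head, B.contract r w ∈ P.vertices ∧
            (B.contract r w = x → w = x)) →
          ∀ w ∈ T.internalVertices, B.contract r w ∈ P.internalVertices := by
        intro T P hT hTr hTx hPr hPx hPT w hw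
        obtain ⟨h₁, h₂, h₃⟩ := (T.mem_internalVertices_iff hT hTr hTx hxr).1 hw
        replace h₁ := (List.mem_cons.1 h₁).resolve_left (hTr ▸ h₂)
        obtain ⟨h₄, h₅⟩ := hPT w h₁
        refine (P.mem_internalVertices_iff hPr hPx hxr).2 ⟨h₄, fun h => h₂ ?_, fun h => h₃ (h₅ h)⟩
        obtain ⟨d, -, rfl⟩ := List.mem_map.1 h₁
        exact hB.eq_root_of_contract_eq d.isLink.right_mem h
      exact fun w hw hw' => hdis (hsub T P hT hTr hTx hPr hPx hPT w hw)
        (hsub T' P' hT' hTr' hTx' hPr' hPx' hPT' w hw')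

/-! ### Vertices outside the skeleton -/

theorem kappa_eq_one (hB : B.IsCleanRooted r) {x : α} (hx : x ∈ V(B.graph))
    (hxp : x ∉ B.plainVertices r) : B.kappa r x = 1 := by
  have hxr : x ≠ r := fun h => hxp (h ▸ hB.root_mem_plainVertices)
  have hc : B.contract r x ≠ x := fun h => hxp (h ▸ hB.contract_mem_plainVertices hx)
  apply le_antisymm
  · refine iSup₂_le fun P hP => Set.encard_le_one_iff.2 fun T T' hT hT' => ?_
    by_contra hne
    have hint : ∀ T ∈ P, B.contract r x ∈ T.internalVertices := by
      intro T hT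
      obtain ⟨hTp, hTr, hTx⟩ := hP.1 hT
      refine (T.mem_internalVertices_iff hTp hTr hTx hxr).2
        ⟨?_, fun h => hxr (hB.eq_root_of_contract_eq hx h), hc⟩
      obtain ⟨a, s, hw⟩ := T.exists_isWalk
      rw [Trail.IsPath, Trail.vertices, hTr] at hTp
      rw [hTr, hTx] at hw
      obtain ⟨A, C, t, hAC, hA, -⟩ := hB.exists_last_plain_contract hw hTp
      rw [Trail.vertices, hTr, hAC, List.map_append, ← List.cons_append]
      exact List.mem_append_left _ hA.finish_mem
    exact hP.2 hT hT' hne (hint T hT) (hint T' hT')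
  · have := (mem_plainVertices_iff hB.root_mem).not.1 hxp
    push Not at this
    obtain ⟨T, hT⟩ := ((this hx).2 1).exists_path hB.root_mem
    refine le_iSup₂_of_le {T} ⟨Set.singleton_subset_iff.2 hT, Set.pairwise_singleton _ _⟩ ?_
    rw [Set.encard_singleton]

end IsCleanRooted

end BidirectedGraph

theorem mainTheorem11 {α β : Type*} (B : BidirectedGraph α β)
    (hV : V(B.graph).Finite) (hE : E(B.graph).Finite)
    (r : α) (hr : r ∈ V(B.graph)) (hclean : B.IsClean r) (hreach : B.IsPathReachable r) :
    (∀ x ∈ (B.skeleton r).vertexSet \ {r}, B.kappa r x = (B.skeleton r).kappa r x) ∧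
    (∀ x ∈ V(B.graph) \ (B.skeleton r).vertexSet, B.kappa r x = 1) := by
  have hB : B.IsCleanRooted r := ⟨hr, hclean, hreach⟩
  refine ⟨fun x hx => ?_, fun x hx => ?_⟩
  · exact le_antisymm (hB.kappa_le_skeleton (hB.mem_vertexSet_skeleton.1 hx.1) hx.2)
      (hB.skeleton_kappa_le hx.2)
  · exact hB.kappa_eq_one hx.1 (mt hB.mem_vertexSet_skeleton.2 hx.2)
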